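/- Let $(V,\omega)$ be a finite-dimensional real symplectic vector space, $\dim V=2n$, and let $Sp(V)$ be its group of linear symplectic automorphisms. Let $\Lambda_{2n}$ be the Lagrangian Grassmannian of $(V\times V,\ \pi_1^*\omega-\pi_2^*\omega)$ with its usual topology. For $L\in\Lambda_{2n}$ put $\ker L=\{v:(v,0)\in L\}$, $\mathrm{halo}\,L=\{v:(0,v)\in L\}$, $\mathrm{dom}\,L=\{v:\exists w,\ (v,w)\in L\}$, and let $$H=\{L\in\Lambda_{2n} : \dim(\mathrm{dom}\,L\cap \mathrm{halo}\,L)\ge 1\}.$$ For $\phi\in Sp(V)$ let $Gr(\phi)=\{(v,\phi v):v\in V\}\in\Lambda_{2n}\setminus H$. For a finite-dimensional symplectic vector space $(W,\omega)$ and $A\in Sp(W)$ let $$\rho(A)=(-1)^{\frac12 m^-}\prod_{\lambda\in S^1\setminus\{\pm1\}}\lambda^{\frac12 m^+(\lambda)}\in S^1,$$ where $m^-$ is the sum of the algebraic multiplicities of the negative real eigenvalues of $A$, and $m^+(\lambda)$ is the number of positive eigenvalues of the real symmetric bilinear form $(z,z')\mapsto \mathrm{Im}\,\omega(z,\overline{z'})$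 on the generalized eigenspace of $\lambda$ in $W\otimes\mathbb C$, regarded as a real vector space ($\omega$ being extended complex bilinearly). Theorem. There exists a unique continuous map $\hat\rho:\Lambda_{2n}\setminus H\to S^1$ such that $\hat\rho(Gr(\phi))=\rho(\phi)^2$ for every $\phi\in Sp(V)$. Moreover, every $L\in\Lambda_{2n}\setminus H$ has a unique decomposition consisting of an $\omega$-orthogonal splitting $V=V_s\oplus V_g$ into symplectic subspaces and a map $\phi_L\in Sp(V_g)$ such that $\ker L$ and $\mathrm{halo}\,L$ are transverse Lagrangian subspaces of $V_s$ and $$L=(\ker L\times\{0\})\oplus(\{0\}\times\mathrm{halo}\,L)\oplus Gr(\phi_L)\ \le\ (V_s\times V_s)\oplus(V_g\times V_g),$$ and $\hat\rho$ is given by $\hat\rho(L)=\rho(\phi_L)^2$. -/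

import Mathlib

open scoped TensorProduct

noncomputable section

namespace LagRel

section Relations

variable {V : Type*} [AddCommGroup V] [Module ℝ V]

/-- `ker L = {v | (v, 0) ∈ L}`. -/
def ker (L : Submodule ℝ (V × V)) : Submodule ℝ V := L.comap (LinearMap.inl ℝ V V)

/-- `halo L = {v | (0, v) ∈ L}`. -/
def halo (L : Submodule ℝ (V × V)) : Submodule ℝ V := L.comap (LinearMap.inr ℝ V V)

/-- `dom L = {v | ∃ w, (v, w) ∈ L}`. -/
def dom (L : Submodule ℝ (V × V)) : Submodule ℝ V := L.map (LinearMap.fst ℝ V V)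

/-- The form `π₁^* ω - π₂^* ω` on `V × V`. -/
def prodForm (ω : LinearMap.BilinForm ℝ V) : LinearMap.BilinForm ℝ (V × V) :=
  ω.comp (LinearMap.fst ℝ V V) (LinearMap.fst ℝ V V) -
    ω.comp (LinearMap.snd ℝ V V) (LinearMap.snd ℝ V V)

/-- `L` is Lagrangian in `(V × V, π₁^* ω - π₂^* ω)`: it is its own symplectic complement. -/
def IsLagrangian (ω : LinearMap.BilinForm ℝ V) (L : Submodule ℝ (V × V)) : Prop :=
  L.orthogonalBilin (prodForm ω) = L

/-- The Lagrangian Grassmannian of `(V × V, π₁^* ω - π₂^* ω)`, as a set. -/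
def LagGr (ω : LinearMap.BilinForm ℝ V) : Type _ :=
  {L : Submodule ℝ (V × V) // IsLagrangian ω L}

/-- The set `H` of those `L` for which `dim (dom L ∩ halo L) ≥ 1`. -/
def exceptionalSet (ω : LinearMap.BilinForm ℝ V) : Set (LagGr ω) :=
  {L | 1 ≤ Module.finrank ℝ ↥(dom L.1 ⊓ halo L.1)}

/-- The group of linear automorphisms of `V` preserving `ω`. -/
def Sp (ω : LinearMap.BilinForm ℝ V) : Subgroup (V ≃ₗ[ℝ] V) where
  carrier := {φ | ∀ v w, ω (φ v) (φ w) = ω v w}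
  mul_mem' := by
    intro φ ψ hφ hψ v w
    simp only [Set.mem_ofPred_eq] at hφ hψ
    rw [LinearEquiv.mul_apply, LinearEquiv.mul_apply, hφ, hψ]
  one_mem' := fun _ _ => rfl
  inv_mem' := by
    intro φ hφ v w
    simp only [Set.mem_ofPred_eq] at hφ
    have h := hφ (φ⁻¹ v) (φ⁻¹ w)
    have e : ∀ x, φ (φ⁻¹ x) = x := fun x => φ.apply_symm_apply x
    rw [e, e] at h
    exact h.symm

/-- The graph `{(v, φ v)}`. -/
def graph (φ : V ≃ₗ[ℝ] V) : Submodule ℝ (V × V) := (φ : V →ₗ[ℝ] V).graph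

lemma isLagrangian_graph {ω : LinearMap.BilinForm ℝ V} (hω : ω.Nondegenerate) (φ : Sp ω) :
    IsLagrangian ω (graph φ.1) := by
  have hφ : ∀ v w, ω (φ.1 v) (φ.1 w) = ω v w := φ.2
  ext ⟨x, y⟩
  rw [Submodule.mem_orthogonalBilin_iff]
  constructor
  · intro h
    have key : ∀ v, ω v (φ.1 x - y) = 0 := by
      intro v
      have h1 := h (φ.1.symm v, v) (by simp [graph, LinearMap.mem_graph_iff])
      have h2 := hφ (φ.1.symm v) x
      simp only [prodForm, LinearMap.sub_apply, LinearMap.BilinForm.comp_apply,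
        LinearMap.fst_apply, LinearMap.snd_apply] at h1
      rw [LinearEquiv.apply_symm_apply] at h2
      rw [map_sub, h2]
      exact h1
    have := hω.2 _ key
    simp only [graph, LinearMap.mem_graph_iff, LinearEquiv.coe_coe]
    exact (sub_eq_zero.mp this).symm
  · rintro h ⟨v, w⟩ hv
    simp only [graph, LinearMap.mem_graph_iff, LinearEquiv.coe_coe] at h hv
    subst h hv
    simp [prodForm, hφ]

lemma halo_graph (φ : V ≃ₗ[ℝ] V) : halo (graph φ) = ⊥ := by
  ext v
  simp [halo, graph, LinearMap.mem_graph_iff]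

/-- The map `Gr`, sending a symplectic automorphism to its graph, with values in the complement
of the exceptional set. -/
def Gr {ω : LinearMap.BilinForm ℝ V} (hω : ω.Nondegenerate) (φ : Sp ω) :
    ↥(exceptionalSet ω)ᶜ :=
  ⟨⟨graph φ.1, isLagrangian_graph hω φ⟩, by
    change ¬ (1 ≤ Module.finrank ℝ ↥(dom (graph φ.1) ⊓ halo (graph φ.1)))
    rw [halo_graph, inf_bot_eq, finrank_bot]
    simp⟩

/-- A decomposition of `L` into a singular part and a graph part: an `ω`-orthogonal splitting
`V = Vs ⊕ Vg` into symplectic subspaces and `φ ∈ Sp(Vg)` such that `ker L` and `halo L` are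
transverse Lagrangian subspaces of `Vs` and
`L = (ker L × 0) ⊕ (0 × halo L) ⊕ Gr(φ) ≤ (Vs × Vs) ⊕ (Vg × Vg)`. -/
structure GraphDecomposition (ω : LinearMap.BilinForm ℝ V) (L : Submodule ℝ (V × V)) where
  Vs : Submodule ℝ V
  Vg : Submodule ℝ V
  isCompl : IsCompl Vs Vg
  orthogonal : ∀ x ∈ Vs, ∀ y ∈ Vg, ω x y = 0
  nondegenerate_Vs : (ω.restrict Vs).Nondegenerate
  nondegenerate_Vg : (ω.restrict Vg).Nondegenerate
  φ : Sp (ω.restrict Vg)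
  ker_lagrangian : Vs ⊓ (ker L).orthogonalBilin ω = ker L
  halo_lagrangian : Vs ⊓ (halo L).orthogonalBilin ω = halo L
  transverse : ker L ⊓ halo L = ⊥
  eq_sum : L = (ker L).prod ⊥ ⊔ (⊥ : Submodule ℝ V).prod (halo L) ⊔
    (graph φ.1).map (Vg.subtype.prodMap Vg.subtype)

end Relations

section Topology

variable {V : Type*} [NormedAddCommGroup V] [NormedSpace ℝ V]

/-- Lagrangian frames: linearly independent families of `dim V` vectors in `V × V` whose span is
Lagrangian. -/
def LagFrame (ω : LinearMap.BilinForm ℝ V) : Type _ :=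
  {b : Fin (Module.finrank ℝ V) → V × V //
    LinearIndependent ℝ b ∧ IsLagrangian ω (Submodule.span ℝ (Set.range b))}

instance (ω : LinearMap.BilinForm ℝ V) : TopologicalSpace (LagFrame ω) :=
  inferInstanceAs (TopologicalSpace {b : Fin (Module.finrank ℝ V) → V × V //
    LinearIndependent ℝ b ∧ IsLagrangian ω (Submodule.span ℝ (Set.range b))})

/-- The Lagrangian subspace spanned by a Lagrangian frame. -/
def LagFrame.span {ω : LinearMap.BilinForm ℝ V} (b : LagFrame ω) : LagGr ω :=
  ⟨Submodule.span ℝ (Set.range b.1), b.2.2⟩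

/-- The usual topology of the Lagrangian Grassmannian, as the quotient of the space of Lagrangian
frames by change of frame. -/
instance (ω : LinearMap.BilinForm ℝ V) : TopologicalSpace (LagGr ω) :=
  TopologicalSpace.coinduced LagFrame.span inferInstance

end Topology

section Rho

variable {V : Type*} [AddCommGroup V] [Module ℝ V]

/-- Complex conjugation on the complexification of `V`. -/
def conj : ℂ ⊗[ℝ] V →ₗ[ℝ] ℂ ⊗[ℝ] V := LinearMap.rTensor V Complex.conjAe.toLinearMap

/-- The real bilinear form `(z, z') ↦ Im ω(z, conj z')` on the complexification of `V`, where `ω`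
is extended complex bilinearly. -/
def kreinForm (ω : LinearMap.BilinForm ℝ V) : LinearMap.BilinForm ℝ (ℂ ⊗[ℝ] V) :=
  LinearMap.mk₂ ℝ (fun z z' => (LinearMap.BilinForm.baseChange ℂ ω z (conj z')).im)
    (by intros; simp)
    (by
      intro c z z'
      rw [← algebraMap_smul ℂ c z, map_smul]
      simp)
    (by intros; simp)
    (by
      intro c z z'
      rw [map_smul, ← algebraMap_smul ℂ c (conj z'), map_smul]
      simp)

/-- The generalized eigenspace of (the complexification of) `A` for `μ`, as a real vector space. -/
def genEigenspace (A : V →ₗ[ℝ] V) (μ : ℂ) : Submodule ℝ (ℂ ⊗[ℝ] V) :=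
  (Module.End.maxGenEigenspace (A.baseChange ℂ) μ).restrictScalars ℝ

/-- `m⁺(μ)`: the number of positive eigenvalues (positive index of inertia) of
`Im ω(z, conj z')` on the generalized eigenspace of `μ`, regarded as a real quadratic form. -/
def mPlus (ω : LinearMap.BilinForm ℝ V) (A : V →ₗ[ℝ] V) (μ : ℂ) : ℕ :=
  sigPos ((kreinForm ω).toQuadraticMap.restrict (genEigenspace A μ))

/-- `m⁻`: the sum of the algebraic multiplicities of the negative real eigenvalues. -/
def mMinus [FiniteDimensional ℝ V] (A : V →ₗ[ℝ] V) : ℕ :=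
  (A.charpoly.roots.filter (fun r => r < 0)).card

/-- `ρ(A) = (-1)^{m⁻/2} ∏_{μ ∈ S¹ ∖ {±1}} μ^{m⁺(μ)/2}`. All factors with `μ` not an eigenvalue are
`1`; for symplectic `A` the numbers `m⁻` and `m⁺(μ)` are even. -/
def rho [FiniteDimensional ℝ V] {ω : LinearMap.BilinForm ℝ V} (A : Sp ω) : Circle :=
  (-1) ^ (mMinus (A.1 : V →ₗ[ℝ] V) / 2) *
    ∏ᶠ (μ : Circle) (_ : μ ≠ 1 ∧ μ ≠ -1), μ ^ (mPlus ω (A.1 : V →ₗ[ℝ] V) μ / 2)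

end Rho

end LagRel

end

/-! The form `kreinForm ω` on the complexification is the real part of a Hermitian form of neutral
signature, and a symplectic map acts by isometries. If such an isometry `g` has an invariant
nonnegative subspace `N` of half the dimension, with no eigenvalue on `N` in the open unit disc,
then the eigenvalues of `g` on `N` determine $\rho^2$. On the circle, the multiplicity of $\mu$ on
`N` is $m^+(\mu)/2$. Outside it, `N` contains the whole generalized eigenspace, so these eigenvalues
come in conjugate pairs whose phases cancel, and the real ones have phase $\pm1$, which squaring
removes. Hence $\rho^2$ is the product of the squared phases of the eigenvalues on `N`
(`circleProd_eq_prod`).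

Such an `N` exists when `g` strictly increases the quadratic form, and the general case follows by
perturbation and compactness of orthonormal frames (`IsKrein.exists_isAdmissible`). The same
compactness makes the product continuous in `g` (`tendsto_circleProd`). The squaring map may be
replaced by any continuous `f` with `f 1 = f (-1) = 1` and `f z⁻¹ = (f z)⁻¹`.

For a relation `L` outside the exceptional set, `dom L` and `halo L` are complementary. Symplectic
duality then forces $V_s=\ker L\oplus\mathrm{halo}\,L$ and $V_g=\mathrm{dom}\,L\cap\mathrm{ran}\,L$.
To see that $\rho(\phi_L)^2$ is continuous in `L`, apply $(x,y)\mapsto(x+sy,\,sx+y)$ with small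
$s>0$: it rescales the symplectic form and turns `L`, and all nearby relations, into graphs of
symplectic maps $\psi$. On $V_s$ the map $\psi$ has eigenvalues $s$ and $1/s$, which do not
contribute. On $V_g$ it is a real Möbius function of $\phi_L$ preserving the circle, so
$\rho(\phi_L)^2$ is a product over the spectrum of $\psi$ with `f` the squared Möbius map
(`GraphDecomposition.rho_sq_eq`). Letting $s\to0$ also shows that graphs are dense, which gives
uniqueness. -/

noncomputable section

set_option linter.unusedSectionVars false

namespace LagRel

open Module Module.End Polynomial Filter Topology

/-! ### Isometries of neutral Hermitian forms and their maximal nonnegative invariant subspaces. -/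

section Krein

variable {W : Type*} [AddCommGroup W] [Module ℂ W] [Module ℝ W] [IsScalarTower ℝ ℂ W]

/-- A nondegenerate real symmetric bilinear form on a complex vector space that is the real part
of a Hermitian form of neutral signature. -/
structure IsKrein (B : LinearMap.BilinForm ℝ W) : Prop where
  symm : ∀ x y, B x y = B y x
  smul : ∀ (c : ℂ) x y, B (c • x) y = B x (starRingEnd ℂ c • y)
  nondeg : ∀ x, (∀ y, B x y = 0) → x = 0
  sigPos_eq : sigPos B.toQuadraticMap = finrank ℂ W
  sigNeg_eq : sigNeg B.toQuadraticMap = finrank ℂ W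

/-- Expanding $B(gx,gy)=B(x,y)$ gives $(\nu\bar\mu-1)B(x,y)$ in terms of pairings with smaller total
nilpotency order, so induction on `k + l` applies. -/
theorem maxGenEigenspace_perp {B : LinearMap.BilinForm ℝ W}
    (hsmul : ∀ (c : ℂ) x y, B (c • x) y = B x (starRingEnd ℂ c • y))
    {g : End ℂ W} (hg : ∀ x y, B (g x) (g y) = B x y) {ν μ : ℂ}
    (hνμ : ν * starRingEnd ℂ μ ≠ 1) {x y : W} (hx : x ∈ g.maxGenEigenspace ν)
    (hy : y ∈ g.maxGenEigenspace μ) : B x y = 0 := by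
  rw [mem_maxGenEigenspace] at hx hy
  obtain ⟨k, hk⟩ := hx
  obtain ⟨l, hl⟩ := hy
  have key : ∀ m k l : ℕ, k + l = m → ∀ x y, ((g - ν • (1 : End ℂ W)) ^ k) x = 0 →
      ((g - μ • (1 : End ℂ W)) ^ l) y = 0 → B x y = 0 := by
    intro m
    induction m with
    | zero =>
      intro k l h x y hx hy
      obtain rfl : k = 0 := by omega
      simp only [pow_zero, Module.End.one_apply] at hx
      simp [hx]
    | succ m ih =>
      intro k l h x y hx hy
      rcases k with _ | k
      · simp only [pow_zero, Module.End.one_apply] at hx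
        simp [hx]
      rcases l with _ | l
      · simp only [pow_zero, Module.End.one_apply] at hy
        simp [hy]
      set c : ℂ := ν * starRingEnd ℂ μ - 1 with hc
      have hc0 : c ≠ 0 := sub_ne_zero.mpr hνμ
      set z := c⁻¹ • x with hz
      have hzx : x = c • z := by rw [hz, smul_smul, mul_inv_cancel₀ hc0, one_smul]
      have hzk : ((g - ν • (1 : End ℂ W)) ^ (k + 1)) z = 0 := by rw [hz, map_smul, hx, smul_zero]
      set z' := (g - ν • (1 : End ℂ W)) z with hz'
      set y' := (g - μ • (1 : End ℂ W)) y with hy'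
      have e1 : g z = ν • z + z' := by simp [hz']
      have e2 : g y = μ • y + y' := by simp [hy']
      have hz'k : ((g - ν • (1 : End ℂ W)) ^ k) z' = 0 := by
        rw [hz', ← Module.End.mul_apply, ← pow_succ]; exact hzk
      have hy'l : ((g - μ • (1 : End ℂ W)) ^ l) y' = 0 := by
        rw [hy', ← Module.End.mul_apply, ← pow_succ]; exact hy
      have a1 : B z' y' = 0 := ih k l.succ (by omega) _ _ hz'k (by
        rw [Nat.succ_eq_add_one, pow_succ', Module.End.mul_apply, hy'l, map_zero])
      have a2 : B z' (μ • y) = 0 := ih k (l + 1) (by omega) _ _ hz'k (by rw [map_smul, hy, smul_zero])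
      have a3 : B (ν • z) y' = 0 := ih (k + 1) l (by omega) _ _ (by rw [map_smul, hzk, smul_zero]) hy'l
      have h1 := hg z y
      rw [e1, e2] at h1
      simp only [map_add, LinearMap.add_apply, a1, a2, a3, add_zero] at h1
      have h2 : B (ν • z) (μ • y) = B ((ν * starRingEnd ℂ μ) • z) y := by
        rw [mul_comm, ← smul_smul, hsmul (starRingEnd ℂ μ), Complex.conj_conj]
      rw [hzx, hc, sub_smul, one_smul, map_sub, LinearMap.sub_apply, ← h2, h1, sub_self]
  exact key _ k l rfl x y hk hl

variable [FiniteDimensional ℂ W]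

theorem finrank_real_eq (N : Submodule ℂ W) :
    finrank ℝ (N.restrictScalars ℝ) = 2 * finrank ℂ N := by
  have := Module.finrank_mul_finrank ℝ ℂ N
  rw [Complex.finrank_real_complex] at this
  exact this.symm

theorem finrank_real_eq' : finrank ℝ W = 2 * finrank ℂ W := by
  have := Module.finrank_mul_finrank ℝ ℂ W
  rw [Complex.finrank_real_complex] at this
  exact this.symm

instance finiteDimensional_real : FiniteDimensional ℝ W := Module.Finite.trans ℂ W

namespace IsKrein

variable {B : LinearMap.BilinForm ℝ W} (hB : IsKrein B)
include hB

theorem finrank_le_of_nonneg {N : Submodule ℝ W} (hN : ∀ x ∈ N, 0 ≤ B x x) :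
    finrank ℝ N ≤ finrank ℂ W := by
  have h := QuadraticForm.sigPos_add_finrank_le_of_nonpos (Q := -B.toQuadraticMap) (V := N)
    (by intro x hx; simpa using hN x hx)
  rw [sigPos_neg, hB.sigNeg_eq, finrank_real_eq' (W := W)] at h
  omega

theorem finrank_le_of_nonpos {N : Submodule ℝ W} (hN : ∀ x ∈ N, B x x ≤ 0) :
    finrank ℝ N ≤ finrank ℂ W := by
  have h := QuadraticForm.sigPos_add_finrank_le_of_nonpos (Q := B.toQuadraticMap) (V := N)
    (by intro x hx; simpa using hN x hx)
  rw [hB.sigPos_eq, finrank_real_eq' (W := W)] at h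
  omega

/-- Adjoining `x` to `N` keeps the form nonnegative, and `N` already has the largest real dimension
that neutral signature allows. -/
theorem mem_of_perp_of_nonneg {N : Submodule ℂ W} (hN : ∀ x ∈ N, 0 ≤ B x x)
    (hdim : 2 * finrank ℂ N = finrank ℂ W) {x : W} (hx : ∀ y ∈ N, B x y = 0)
    (hxx : 0 ≤ B x x) : x ∈ N := by
  have h1 : ∀ z ∈ N.restrictScalars ℝ ⊔ ℝ ∙ x, 0 ≤ B z z := by
    intro z hz
    obtain ⟨y, hy, w, hw, rfl⟩ := Submodule.mem_sup.mp hz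
    obtain ⟨r, rfl⟩ := Submodule.mem_span_singleton.mp hw
    have e1 := hx y hy
    have e2 : B y x = 0 := by rw [hB.symm, e1]
    have := hN y hy
    simp only [map_add, LinearMap.add_apply, map_smul, LinearMap.smul_apply, e1, e2, smul_eq_mul]
    have := mul_nonneg (mul_self_nonneg r) hxx
    nlinarith
  have h2 := hB.finrank_le_of_nonneg h1
  rw [← hdim, ← finrank_real_eq] at h2
  have h3 := Submodule.eq_of_le_of_finrank_le (le_sup_left : N.restrictScalars ℝ ≤ _ ⊔ ℝ ∙ x) h2
  have : x ∈ N.restrictScalars ℝ := by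
    rw [h3]; exact Submodule.mem_sup_right (Submodule.mem_span_singleton_self x)
  exact this

/-- The complex orthogonal complement. -/
def perp (N : Submodule ℂ W) : Submodule ℂ W where
  carrier := {x | ∀ y ∈ N, B x y = 0}
  add_mem' := by intro a b ha hb y hy; simp [ha y hy, hb y hy]
  zero_mem' := by simp
  smul_mem' := by
    intro c x hx y hy
    rw [hB.smul]
    exact hx _ (N.smul_mem _ hy)

theorem isRefl : B.IsRefl := fun x y h => by rw [hB.symm, h]

theorem nondegenerate : B.Nondegenerate :=
  ⟨hB.nondeg, fun y h => hB.nondeg y fun x => by rw [hB.symm]; exact h x⟩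

theorem mem_of_perp_perp {N : Submodule ℂ W} {x : W} (hx : ∀ y ∈ hB.perp N, B x y = 0) :
    x ∈ N := by
  have h := LinearMap.BilinForm.orthogonal_orthogonal hB.nondegenerate hB.isRefl
    (N.restrictScalars ℝ)
  have : x ∈ N.restrictScalars ℝ := by
    rw [← h, LinearMap.BilinForm.mem_orthogonal_iff]
    intro y hy
    rw [LinearMap.BilinForm.mem_orthogonal_iff] at hy
    have := hx y (fun z hz => by rw [hB.symm]; exact hy z hz)
    change B y x = 0
    rw [hB.symm, this]
  exact this

theorem nonpos_of_mem_perp {N : Submodule ℂ W} (hN : ∀ x ∈ N, 0 ≤ B x x)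
    (hdim : 2 * finrank ℂ N = finrank ℂ W) {x : W} (hx : x ∈ hB.perp N) : B x x ≤ 0 := by
  by_contra h
  push Not at h
  have := hB.mem_of_perp_of_nonneg hN hdim hx h.le
  exact h.ne' (hx x this)

variable {g : End ℂ W} (hg : ∀ x y, B (g x) (g y) = B x y)
include hg

theorem injective_of_isometry : Function.Injective g := by
  rw [injective_iff_map_eq_zero]
  intro x hx
  refine hB.nondeg x fun y => ?_
  rw [← hg, hx, map_zero, LinearMap.zero_apply]

theorem perp_invariant {N : Submodule ℂ W} (hgN : ∀ x ∈ N, g x ∈ N) :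
    ∀ x ∈ hB.perp N, g x ∈ hB.perp N := by
  intro x hx y hy
  have hs : Function.Surjective (g.restrict hgN) := LinearMap.surjective_of_injective
    (by intro a b h; exact Subtype.ext (hB.injective_of_isometry hg (congrArg Subtype.val h)))
  obtain ⟨z, hz⟩ := hs ⟨y, hy⟩
  have hz' : g z = y := congrArg Subtype.val hz
  rw [← hz', hg]
  exact hx z z.2

-- An invariant subspace is the sum of its intersections with the generalized eigenspaces.
omit hB hg in
theorem mem_of_forall_inf_maxGenEigenspace_le {N : Submodule ℂ W} (hgN : ∀ x ∈ N, g x ∈ N)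
    {P : Submodule ℝ W} (h : ∀ μ : ℂ, ∀ x ∈ N, x ∈ g.maxGenEigenspace μ → x ∈ P) :
    ∀ x ∈ N, x ∈ P := by
  intro x hx
  have := Submodule.eq_iSup_inf_genEigenspace (f := g) (p := N) ⊤ hgN
    (iSup_maxGenEigenspace_eq_top g)
  rw [this] at hx
  induction hx using Submodule.iSup_induction' with
  | mem μ x hx => exact h μ x hx.1 hx.2
  | zero => exact P.zero_mem
  | add x y _ _ hx hy => exact P.add_mem hx hy

theorem mem_perp_real {N : Submodule ℂ W} (hgN : ∀ x ∈ N, g x ∈ N) {μ : ℂ} {x : W}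
    (hx : x ∈ g.maxGenEigenspace μ)
    (h : ∀ y ∈ N, ∀ ν, μ * starRingEnd ℂ ν = 1 → y ∈ g.maxGenEigenspace ν → B x y = 0) :
    ∀ y ∈ N, B x y = 0 := by
  have := mem_of_forall_inf_maxGenEigenspace_le (g := g) hgN (P := LinearMap.ker (B x)) (by
    intro ν y hy hyν
    rw [LinearMap.mem_ker]
    by_cases hν : μ * starRingEnd ℂ ν = 1
    · exact h y hy ν hν hyν
    · exact maxGenEigenspace_perp hB.smul hg hν hx hyν)
  exact fun y hy => this y hy

/-- By double orthogonality it suffices to pair with the complement of `N`. Only eigenvalues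
$\nu=1/\bar\mu$ inside the disc matter there. Their vectors are isotropic, hence lie in `N` by
maximality, where no such eigenvalue occurs. -/
theorem maxGenEigenspace_le_of_one_lt {N : Submodule ℂ W} (hN : ∀ x ∈ N, 0 ≤ B x x)
    (hdim : 2 * finrank ℂ N = finrank ℂ W) (hgN : ∀ x ∈ N, g x ∈ N)
    (hsmall : ∀ μ : ℂ, ‖μ‖ < 1 → ∀ x ∈ N, x ∈ g.maxGenEigenspace μ → x = 0)
    {μ : ℂ} (hμ : 1 < ‖μ‖) : g.maxGenEigenspace μ ≤ N := by
  intro x hx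
  refine hB.mem_of_perp_perp ?_
  refine hB.mem_perp_real hg (hB.perp_invariant hg hgN) hx ?_
  intro y hy ν hμν hyν
  have hν : ‖ν‖ < 1 := by
    have := congrArg norm hμν
    rw [norm_mul, RCLike.norm_conj, norm_one] at this
    by_contra h
    push Not at h
    nlinarith
  have hyy : B y y = 0 := by
    refine maxGenEigenspace_perp hB.smul hg ?_ hyν hyν
    intro h
    have := congrArg norm h
    rw [norm_mul, RCLike.norm_conj, norm_one] at this
    nlinarith [norm_nonneg ν]
  have hyN := hB.mem_of_perp_of_nonneg hN hdim hy hyy.ge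
  rw [hsmall ν hν y hyN hyν, map_zero]

/-- Within the generalized eigenspace the form is nonnegative on the trace `F` of `N` and
nonpositive on the orthogonal of `F`. The second fact bounds the positive index above by $\dim F$;
the first, with nondegeneracy, bounds it below. `F` itself may be degenerate. -/
theorem sigPos_maxGenEigenspace {N : Submodule ℂ W} (hN : ∀ x ∈ N, 0 ≤ B x x)
    (hdim : 2 * finrank ℂ N = finrank ℂ W) (hgN : ∀ x ∈ N, g x ∈ N)
    {μ : ℂ} (hμ : ‖μ‖ = 1) :
    sigPos (B.toQuadraticMap.restrict ((g.maxGenEigenspace μ).restrictScalars ℝ)) =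
      2 * finrank ℂ ↥(N ⊓ g.maxGenEigenspace μ) := by
  have hμν : ∀ ν, μ * starRingEnd ℂ ν = 1 → ν = μ := by
    intro ν h
    have h1 : μ * starRingEnd ℂ μ = 1 := by
      rw [Complex.mul_conj, Complex.normSq_eq_norm_sq, hμ]; norm_num
    have h0 : μ ≠ 0 := by rintro rfl; simp at h
    have := mul_left_cancel₀ h0 (h.trans h1.symm)
    exact (starRingEnd ℂ).injective this
  set E : Submodule ℝ W := (g.maxGenEigenspace μ).restrictScalars ℝ with hE
  set Q := B.toQuadraticMap.restrict E with hQ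
  set F : Submodule ℝ W := (N ⊓ g.maxGenEigenspace μ).restrictScalars ℝ with hF
  have hFE : F ≤ E := fun x hx => hx.2
  have hFd : finrank ℝ (F.comap E.subtype) = 2 * finrank ℂ ↥(N ⊓ g.maxGenEigenspace μ) := by
    rw [← finrank_real_eq, ← hF, (Submodule.comapSubtypeEquivOfLe hFE).finrank_eq]
  rw [← hFd]
  have hQa : ∀ x, Q x = B x x := fun x => by simp [hQ]
  set BE : LinearMap.BilinForm ℝ E := B.restrict E with hBE
  have hBEr : BE.IsRefl := fun x y h => by
    have : B x y = 0 := h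
    change B y x = 0
    rw [hB.symm, this]
  have hperp : ∀ x ∈ BE.orthogonal (F.comap E.subtype), Q x ≤ 0 := by
    intro x hx
    rw [LinearMap.BilinForm.mem_orthogonal_iff] at hx
    rw [hQa]
    refine hB.nonpos_of_mem_perp hN hdim (hB.mem_perp_real hg hgN x.2 ?_)
    intro y hy ν hν hyν
    obtain rfl := hμν ν hν
    have : B y x = 0 := hx ⟨y, hyν⟩ ⟨hy, hyν⟩
    rw [hB.symm, this]
  have h1 := QuadraticForm.sigPos_add_finrank_le_of_nonpos hperp
  have h2 := LinearMap.BilinForm.finrank_add_finrank_orthogonal hBEr (F.comap E.subtype)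
  have h3 := QuadraticForm.sigPos_add_finrank_le_of_nonpos (Q := -Q) (V := F.comap E.subtype) (by
    intro x hx
    rw [neg_apply, hQa]
    have := hN x hx.1
    linarith)
  rw [sigPos_neg] at h3
  have h4 := QuadraticForm.sigPos_add_sigNeg_add_radical (Q := Q)
  -- For $|\mu|=1$ this generalized eigenspace is orthogonal to all the others, so it inherits
  -- nondegeneracy from the whole space.
  have h5 : Q.radical = ⊥ := by
    rw [eq_bot_iff]
    intro x hx
    rw [QuadraticMap.mem_radical_iff'] at hx
    have hz : ∀ y : E, B x y = 0 := by
      intro y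
      have e := hx.2 y
      have e0 := hx.1
      rw [hQa] at e e0
      rw [hQa, Submodule.coe_add, map_add, map_add, LinearMap.add_apply, LinearMap.add_apply,
        hB.symm y x, e0] at e
      linarith
    have : (x : W) = 0 := by
      refine hB.nondeg _ fun y => ?_
      refine hB.mem_perp_real hg (N := ⊤) (by simp) x.2 ?_ y trivial
      intro y _ ν hν hyν
      obtain rfl := hμν ν hν
      exact hz ⟨y, hyν⟩
    simpa using this
  rw [h5, finrank_bot] at h4
  omega

end IsKrein

end Krein

/-! ### The phase of a nonzero complex number. -/

section Phase

/-- The phase `z / ‖z‖` of a nonzero complex number. -/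
def phase (z : ℂ) : Circle := Circle.exp z.arg

theorem coe_phase {z : ℂ} (hz : z ≠ 0) : (phase z : ℂ) = z / ‖z‖ := by
  rw [phase, Circle.coe_exp, eq_div_iff (by simpa using hz), mul_comm]
  exact Complex.norm_mul_exp_arg_mul_I z

theorem phase_coe (z : Circle) : phase z = z := by
  refine Circle.ext ?_
  rw [coe_phase (Circle.coe_ne_zero z), Circle.norm_coe]
  simp

theorem phase_conj {z : ℂ} (hz : z ≠ 0) : phase (starRingEnd ℂ z) = (phase z)⁻¹ := by
  refine Circle.ext ?_
  rw [Circle.coe_inv_eq_conj, coe_phase hz, coe_phase (by simpa using hz)]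
  simp

theorem phase_of_conj_eq {z : ℂ} (hz : z ≠ 0) (h : starRingEnd ℂ z = z) :
    phase z = 1 ∨ phase z = -1 := by
  have h1 := phase_conj hz
  rw [h] at h1
  have h2 : ((phase z : ℂ)) * phase z = 1 := by
    rw [← Circle.coe_mul, mul_eq_one_iff_eq_inv.mpr h1, Circle.coe_one]
  rcases mul_self_eq_one_iff.mp h2 with h | h
  · left; exact Circle.ext (by simpa using h)
  · right; exact Circle.ext (by simpa using h)

theorem continuousAt_phase {z : ℂ} (hz : z ≠ 0) : ContinuousAt phase z := by
  have he : Topology.IsInducing (fun z : Circle => (z : ℂ)) := ⟨rfl⟩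
  rw [he.continuousAt_iff]
  have h1 : ContinuousAt (fun w : ℂ => w / (‖w‖ : ℂ)) z := by
    refine continuousAt_id.div (by fun_prop) (by simpa using hz)
  refine h1.congr ?_
  filter_upwards [isOpen_ne.mem_nhds hz] with w hw
  exact (coe_phase hw).symm

end Phase

/-! ### The circle product evaluated on the eigenvalues of an admissible subspace. -/

section Eval

variable {W : Type*} [AddCommGroup W] [Module ℂ W] [Module ℝ W] [IsScalarTower ℝ ℂ W]

/-- A real structure: a conjugate linear involution. -/
structure IsConj (c : W →ₗ[ℝ] W) : Prop where
  smul : ∀ (z : ℂ) x, c (z • x) = starRingEnd ℂ z • c x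
  invol : ∀ x, c (c x) = x

/-- The product of `f μ ^ p(μ)` over the unit circle except `±1`, where `2 p(μ)` is the positive
index of inertia of `B` on the generalized eigenspace of `μ`. -/
def circleProd (f : Circle → Circle) (B : LinearMap.BilinForm ℝ W) (g : End ℂ W) : Circle :=
  ∏ᶠ (μ : Circle) (_ : μ ≠ 1 ∧ μ ≠ -1),
    f μ ^ (sigPos (B.toQuadraticMap.restrict ((g.maxGenEigenspace μ).restrictScalars ℝ)) / 2)

variable [FiniteDimensional ℂ W]

/-- `z` lists the eigenvalues of `g` on an invariant nonnegative subspace, and they lie outside the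
open unit disc. -/
def IsAdmissible {n : ℕ} (B : LinearMap.BilinForm ℝ W) (g : End ℂ W) (z : Fin n → ℂ) : Prop :=
  ∃ (N : Submodule ℂ W) (hN : ∀ x ∈ N, g x ∈ N), (∀ x ∈ N, 0 ≤ B x x) ∧ finrank ℂ N = n ∧
    (g.restrict hN).charpoly = ∏ i, (X - C (z i)) ∧ ∀ i, 1 ≤ ‖z i‖

theorem IsConj.finrank_maxGenEigenspace {c : W →ₗ[ℝ] W} (hc : IsConj c) {g : End ℂ W}
    (hcg : ∀ x, c (g x) = g (c x)) (z : ℂ) :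
    finrank ℂ (g.maxGenEigenspace (starRingEnd ℂ z)) = finrank ℂ (g.maxGenEigenspace z) := by
  have hpow : ∀ (w : ℂ) (k : ℕ) x, c (((g - w • (1 : End ℂ W)) ^ k) x) =
      ((g - starRingEnd ℂ w • (1 : End ℂ W)) ^ k) (c x) := by
    intro w k
    induction k with
    | zero => simp
    | succ k ih =>
      intro x
      rw [pow_succ, Module.End.mul_apply, ih, pow_succ, Module.End.mul_apply]
      simp [hcg, hc.smul]
  have hinj : Function.Injective c := Function.LeftInverse.injective hc.invol
  have key : ∀ w : ℂ, finrank ℝ ((g.maxGenEigenspace w).restrictScalars ℝ) ≤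
      finrank ℝ ((g.maxGenEigenspace (starRingEnd ℂ w)).restrictScalars ℝ) := by
    intro w
    rw [(Submodule.equivMapOfInjective c hinj _).finrank_eq]
    refine Submodule.finrank_mono ?_
    rintro _ ⟨x, hx, rfl⟩
    have hx' : x ∈ g.maxGenEigenspace w := hx
    rw [mem_maxGenEigenspace] at hx'
    obtain ⟨k, hk⟩ := hx'
    change c x ∈ g.maxGenEigenspace _
    rw [mem_maxGenEigenspace]
    exact ⟨k, by rw [← hpow, hk, map_zero]⟩
  have h1 := key z
  have h2 := key (starRingEnd ℂ z)
  rw [Complex.conj_conj] at h2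
  simp only [finrank_real_eq] at h1 h2
  omega

theorem finrank_inf_maxGenEigenspace {g : End ℂ W} {N : Submodule ℂ W}
    (hN : ∀ x ∈ N, g x ∈ N) (μ : ℂ) :
    finrank ℂ ↥(N ⊓ g.maxGenEigenspace μ) = (g.restrict hN).charpoly.rootMultiplicity μ := by
  rw [← LinearMap.finrank_maxGenEigenspace_eq]
  have : maxGenEigenspace (g.restrict hN) μ = (g.maxGenEigenspace μ).comap N.subtype :=
    genEigenspace_restrict g N ⊤ μ hN
  rw [this, ← Submodule.map_comap_subtype, Submodule.finrank_map_subtype_eq]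

/-- The right side depends on a choice of admissible list and the left side does not. This
independence is what later allows passing to limits along arbitrary choices. -/
theorem circleProd_eq_prod {f : Circle → Circle} (hf1 : f 1 = 1) (hfm : f (-1) = 1)
    (hfinv : ∀ z, f z⁻¹ = (f z)⁻¹)
    {B : LinearMap.BilinForm ℝ W} (hB : IsKrein B) {c : W →ₗ[ℝ] W} (hc : IsConj c)
    {g : End ℂ W} (hg : ∀ x y, B (g x) (g y) = B x y) (hcg : ∀ x, c (g x) = g (c x))
    {n : ℕ} (hn : 2 * n = finrank ℂ W) {z : Fin n → ℂ} (hz : IsAdmissible B g z) :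
    circleProd f B g = ∏ i, f (phase (z i)) := by
  classical
  obtain ⟨N, hgN, hN, hNn, hchar, hz1⟩ := hz
  have hdim : 2 * finrank ℂ N = finrank ℂ W := by rw [hNn, hn]
  set d : ℂ → ℕ := fun μ => finrank ℂ ↥(N ⊓ g.maxGenEigenspace μ) with hd
  have hchar0 : (g.restrict hgN).charpoly ≠ 0 := (LinearMap.charpoly_monic _).ne_zero
  have hroots : (g.restrict hgN).charpoly.roots = Finset.univ.val.map z := by
    rw [hchar]
    have := Polynomial.roots_multiset_prod_X_sub_C (Finset.univ.val.map z)
    rw [Multiset.map_map] at this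
    exact this
  have hcount : ∀ μ, (Finset.univ.val.map z).count μ = d μ := by
    intro μ
    rw [← hroots, count_roots, hd]
    exact (finrank_inf_maxGenEigenspace hgN μ).symm
  have hd0 : ∀ μ, μ ∉ Set.range z → d μ = 0 := by
    intro μ hμ
    rw [← hcount, Multiset.count_eq_zero]
    simpa using hμ
  have hsmall : ∀ μ : ℂ, ‖μ‖ < 1 → d μ = 0 := by
    intro μ hμ
    refine hd0 μ ?_
    rintro ⟨i, rfl⟩
    exact absurd (hz1 i) (not_le.mpr hμ)
  have hsmall' : ∀ μ : ℂ, ‖μ‖ < 1 → ∀ x ∈ N, x ∈ g.maxGenEigenspace μ → x = 0 := by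
    intro μ hμ x hx hxμ
    have := Submodule.finrank_eq_zero.mp (hsmall μ hμ)
    have hx' : x ∈ N ⊓ g.maxGenEigenspace μ := ⟨hx, hxμ⟩
    rw [this] at hx'
    simpa using hx'
  have hlarge : ∀ μ : ℂ, 1 < ‖μ‖ → d μ = finrank ℂ (g.maxGenEigenspace μ) := by
    intro μ hμ
    rw [hd]
    simp only
    rw [inf_eq_right.mpr (hB.maxGenEigenspace_le_of_one_lt hg hN hdim hgN hsmall' hμ)]
  set F : ℂ → Circle := fun w => f (phase w) with hF
  set S : Finset ℂ := Finset.univ.image z with hS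
  have hprod : ∏ i, F (z i) = ∏ μ ∈ S, F μ ^ d μ := by
    have h1 := Finset.prod_multiset_map_count (Finset.univ.val.map z) F
    rw [Multiset.map_map] at h1
    change ∏ i, F (z i) = _ at h1
    rw [h1]
    refine Finset.prod_congr ?_ fun μ _ => by rw [hcount]
    ext; simp [hS]
  have hSd : ∀ μ, μ ∈ S ↔ d μ ≠ 0 := by
    intro μ
    rw [← hcount, Multiset.count_ne_zero]
    simp [hS]
  -- Conjugation is an involution on the eigenvalues outside the closed disc. It preserves
  -- multiplicities because there `d` counts the full generalized eigenspace. Fixed points are real,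
  -- with phase $\pm1$, where `f` is trivial.
  have hlargeprod : ∏ μ ∈ S with ¬ ‖μ‖ = 1, F μ ^ d μ = 1 := by
    have hmem : ∀ μ, μ ∈ S → ¬ ‖μ‖ = 1 → 1 < ‖μ‖ := by
      intro μ hμ h1
      rw [hSd] at hμ
      rcases lt_trichotomy ‖μ‖ 1 with h | h | h
      · exact absurd (hsmall μ h) hμ
      · exact absurd h h1
      · exact h
    have hdc : ∀ μ, 1 < ‖μ‖ → d (starRingEnd ℂ μ) = d μ := by
      intro μ h
      rw [hlarge μ h, hlarge _ (by rwa [RCLike.norm_conj]), hc.finrank_maxGenEigenspace hcg]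
    have hne : ∀ μ : ℂ, 1 < ‖μ‖ → μ ≠ 0 := by
      rintro μ h rfl
      simp at h
      linarith
    refine Finset.prod_involution (fun μ _ => starRingEnd ℂ μ) ?_ ?_ ?_ ?_
    · intro μ hμ
      obtain ⟨hμ1, hμ2⟩ := Finset.mem_filter.mp hμ
      have h := hmem μ hμ1 hμ2
      rw [hdc μ h, hF]
      simp only
      rw [phase_conj (hne μ h), hfinv, ← mul_pow, mul_inv_cancel, one_pow]
    · intro μ hμ h1 h2
      obtain ⟨hμ1, hμ2⟩ := Finset.mem_filter.mp hμ
      have h := hmem μ hμ1 hμ2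
      apply h1
      rw [hF]
      simp only
      rcases phase_of_conj_eq (hne μ h) h2 with h3 | h3 <;> rw [h3]
      · rw [hf1, one_pow]
      · rw [hfm, one_pow]
    · intro μ hμ
      obtain ⟨hμ1, hμ2⟩ := Finset.mem_filter.mp hμ
      have h := hmem μ hμ1 hμ2
      rw [Finset.mem_filter, hSd, hdc μ h, RCLike.norm_conj]
      exact ⟨(hSd μ).mp hμ1, hμ2⟩
    · intro μ _
      exact Complex.conj_conj μ
  -- Since `f` is trivial at $\pm1$, the exclusion of these points can be dropped.
  have hcirc : circleProd f B g = ∏ᶠ μ : Circle, f μ ^ d μ := by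
    refine finprod_congr fun μ => ?_
    rw [hB.sigPos_maxGenEigenspace hg hN hdim hgN (Circle.norm_coe μ),
      Nat.mul_div_cancel_left _ two_pos]
    rw [finprod_eq_if]
    split_ifs with h
    · rfl
    · by_cases h1 : μ = 1
      · rw [h1, hf1, one_pow]
      · have h2 : μ = -1 := by tauto
        rw [h2, hfm, one_pow]
  change _ = ∏ i, F (z i)
  rw [hcirc, hprod, ← Finset.prod_filter_mul_prod_filter_not S (fun μ => ‖μ‖ = 1), hlargeprod,
    mul_one]
  rw [finprod_eq_prod_of_mulSupport_subset (s := (S.filter fun μ => ‖μ‖ = 1).image phase)]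
  · rw [Finset.prod_image]
    · refine Finset.prod_congr rfl fun μ hμ => ?_
      have h := (Finset.mem_filter.mp hμ).2
      have : (phase μ : ℂ) = μ := by
        rw [coe_phase (by rintro rfl; simp at h), h]; simp
      rw [this]
    · intro a ha b hb hab
      have h : ∀ μ ∈ (S.filter fun μ => ‖μ‖ = 1), (phase μ : ℂ) = μ := by
        intro μ hμ
        have h := (Finset.mem_filter.mp hμ).2
        rw [coe_phase (by rintro rfl; simp at h), h]; simp
      rw [← h a ha, ← h b hb]
      exact congrArg _ hab
  · intro μ hμ
    rw [Function.mem_mulSupport] at hμ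
    have : d μ ≠ 0 := by
      intro h
      rw [h, pow_zero] at hμ
      exact hμ rfl
    rw [Finset.mem_coe, Finset.mem_image]
    exact ⟨μ, Finset.mem_filter.mpr ⟨(hSd μ).mpr this, Circle.norm_coe μ⟩, phase_coe μ⟩

end Eval

/-! ### Compactness of admissible eigenvalue lists. -/

section Closed

variable {W : Type*} [NormedAddCommGroup W] [InnerProductSpace ℂ W] [FiniteDimensional ℂ W]
  [Module ℝ W] [IsScalarTower ℝ ℂ W]

/-- Admissible families in terms of orthonormal frames. -/
def IsFrame {n : ℕ} (B : LinearMap.BilinForm ℝ W) (A : W →L[ℂ] W) (z : Fin n → ℂ)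
    (e : Fin n → W) : Prop :=
  (∀ i j, inner ℂ (e i) (e j) = if i = j then (1 : ℂ) else 0) ∧
  (∀ j, A (e j) = ∑ i, inner ℂ (e i) (A (e j)) • e i) ∧
  (∀ a : Fin n → ℂ, 0 ≤ B (∑ i, a i • e i) (∑ i, a i • e i)) ∧
  (∀ w : ℂ, (Matrix.scalar (Fin n) w - Matrix.of fun i j => inner ℂ (e i) (A (e j))).det =
    ∏ i, (w - z i)) ∧
  ∀ i, 1 ≤ ‖z i‖

/-- Orthonormal frames replace the varying subspace by bounded vectors subject to closed conditions.
The characteristic polynomial becomes a family of determinant identities, one for each `w`. -/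
theorem IsAdmissible.exists_isFrame {n : ℕ} {B : LinearMap.BilinForm ℝ W} {A : W →L[ℂ] W}
    {z : Fin n → ℂ} (h : IsAdmissible B (A : End ℂ W) z) : ∃ e, IsFrame B A z e := by
  obtain ⟨N, hgN, hN, hNn, hchar, hz1⟩ := h
  set b : OrthonormalBasis (Fin n) ℂ N := (stdOrthonormalBasis ℂ N).reindex (finCongr hNn) with hb
  refine ⟨fun i => b i, ?_, ?_, ?_, ?_, hz1⟩
  · intro i j
    exact orthonormal_iff_ite.mp b.orthonormal i j
  · intro j
    have h1 := congrArg (Subtype.val) (b.sum_repr ((A : End ℂ W).restrict hgN (b j))).symm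
    simp only [b.repr_apply_apply] at h1
    simpa using h1
  · intro a
    exact hN _ (N.sum_mem fun i _ => N.smul_mem _ (b i).2)
  · intro w
    have h1 : ((A : End ℂ W).restrict hgN).charpoly.eval w = ∏ i, (w - z i) := by
      rw [hchar, eval_prod]; simp
    rw [← h1, ← LinearMap.charpoly_toMatrix _ b.toBasis, Matrix.eval_charpoly]
    congr 2
    ext i j
    simp [LinearMap.toMatrix_apply, b.repr_apply_apply]

theorem IsFrame.isAdmissible {n : ℕ} {B : LinearMap.BilinForm ℝ W} {A : W →L[ℂ] W}
    {z : Fin n → ℂ} {e : Fin n → W} (h : IsFrame B A z e) : IsAdmissible B (A : End ℂ W) z := by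
  obtain ⟨h1, h2, h3, h4, h5⟩ := h
  have hon : Orthonormal ℂ e := orthonormal_iff_ite.mpr h1
  set N := Submodule.span ℂ (Set.range e) with hNdef
  have heN : ∀ i, e i ∈ N := fun i => Submodule.subset_span ⟨i, rfl⟩
  have hgN : ∀ x ∈ N, (A : End ℂ W) x ∈ N := by
    intro x hx
    induction hx using Submodule.span_induction with
    | mem x hx =>
      obtain ⟨j, rfl⟩ := hx
      change A (e j) ∈ N
      rw [h2 j]
      exact N.sum_mem fun i _ => N.smul_mem _ (heN i)
    | zero => rw [map_zero]; exact N.zero_mem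
    | add x y _ _ hx hy => rw [map_add]; exact N.add_mem hx hy
    | smul c x _ hx => rw [map_smul]; exact N.smul_mem c hx
  set b : Basis (Fin n) ℂ N := Basis.span hon.linearIndependent with hb
  have hbe : ∀ i, (b i : W) = e i := fun i => by rw [hb, Basis.span_apply]
  refine ⟨N, hgN, ?_, ?_, ?_, h5⟩
  · intro x hx
    obtain ⟨a, rfl⟩ := (Submodule.mem_span_range_iff_exists_fun ℂ).mp hx
    exact h3 a
  · rw [finrank_eq_card_basis b, Fintype.card_fin]
  · refine Polynomial.funext fun w => ?_
    rw [eval_prod]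
    simp only [eval_sub, eval_X, eval_C]
    rw [← h4 w, ← LinearMap.charpoly_toMatrix _ b, Matrix.eval_charpoly]
    congr 2
    ext i j
    rw [LinearMap.toMatrix_apply]
    have : (A : End ℂ W).restrict hgN (b j) = ∑ i, inner ℂ (e i) (A (e j)) • b i := by
      refine Subtype.ext ?_
      simp only [LinearMap.coe_restrict_apply, hbe, Submodule.coe_sum, Submodule.coe_smul]
      exact h2 j
    rw [this, map_sum]
    simp [Finsupp.single_apply]

theorem IsAdmissible.norm_le {n : ℕ} {B : LinearMap.BilinForm ℝ W} {A : W →L[ℂ] W}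
    {z : Fin n → ℂ} (h : IsAdmissible B (A : End ℂ W) z) (i : Fin n) : ‖z i‖ ≤ ‖A‖ := by
  obtain ⟨N, hgN, hN, hNn, hchar, hz1⟩ := h
  have hroot : ((A : End ℂ W).restrict hgN).charpoly.IsRoot (z i) := by
    rw [hchar, IsRoot, eval_prod]
    exact Finset.prod_eq_zero (Finset.mem_univ i) (by simp)
  rw [← hasEigenvalue_iff_isRoot_charpoly] at hroot
  obtain ⟨v, hv⟩ := hroot.exists_hasEigenvector
  have h1 : A v = z i • (v : W) := congrArg Subtype.val hv.apply_eq_smul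
  have h2 : (v : W) ≠ 0 := fun h => hv.2 (Subtype.ext h)
  have h3 := A.le_opNorm v
  rw [h1, norm_smul] at h3
  exact le_of_mul_le_mul_right h3 (norm_pos_iff.mpr h2)

/-- Frames are unit vectors and eigenvalues are bounded by operator norms, so Bolzano–Weierstrass
applies; each clause of `IsFrame` survives the limit. -/
theorem IsAdmissible.exists_subseq {n : ℕ} {B : LinearMap.BilinForm ℝ W}
    (hq : Continuous fun x => B x x) {A : ℕ → W →L[ℂ] W} {A₀ : W →L[ℂ] W}
    (hA : Tendsto A atTop (𝓝 A₀)) {z : ℕ → Fin n → ℂ}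
    (hz : ∀ k, IsAdmissible B (A k : End ℂ W) (z k)) :
    ∃ z₀, IsAdmissible B (A₀ : End ℂ W) z₀ ∧
      ∃ φ : ℕ → ℕ, StrictMono φ ∧ Tendsto (z ∘ φ) atTop (𝓝 z₀) := by
  choose e he using fun k => (hz k).exists_isFrame
  obtain ⟨R, hR⟩ := hA.norm.bddAbove_range
  have hR' : ∀ k, ‖A k‖ ≤ R := fun k => hR ⟨k, rfl⟩
  have hR0 : 0 ≤ R := (norm_nonneg _).trans (hR' 0)
  have hbdd : ∀ k, (e k, z k) ∈ Metric.closedBall (0 : (Fin n → W) × (Fin n → ℂ)) (max 1 R) := by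
    intro k
    rw [mem_closedBall_zero_iff, Prod.norm_def]
    refine max_le_max ?_ ?_
    · rw [pi_norm_le_iff_of_nonneg zero_le_one]
      intro i
      exact ((orthonormal_iff_ite.mpr (he k).1).norm_eq_one i).le
    · rw [pi_norm_le_iff_of_nonneg hR0]
      exact fun i => ((hz k).norm_le i).trans (hR' k)
  obtain ⟨⟨e₀, z₀⟩, -, φ, hφ, hlim⟩ := tendsto_subseq_of_bounded Metric.isBounded_closedBall hbdd
  have hzl : Tendsto (z ∘ φ) atTop (𝓝 z₀) := (continuous_snd.tendsto _).comp hlim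
  have hel : Tendsto (e ∘ φ) atTop (𝓝 e₀) := (continuous_fst.tendsto _).comp hlim
  have hel' : ∀ i, Tendsto (fun k => e (φ k) i) atTop (𝓝 (e₀ i)) := fun i =>
    ((continuous_apply i).tendsto _).comp hel
  have hzl' : ∀ i, Tendsto (fun k => z (φ k) i) atTop (𝓝 (z₀ i)) := fun i =>
    ((continuous_apply i).tendsto _).comp hzl
  have hAl : Tendsto (fun k => A (φ k)) atTop (𝓝 A₀) := hA.comp hφ.tendsto_atTop
  have hAel : ∀ j, Tendsto (fun k => A (φ k) (e (φ k) j)) atTop (𝓝 (A₀ (e₀ j))) := fun j =>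
    ((isBoundedBilinearMap_apply (𝕜 := ℂ)).continuous.tendsto (A₀, e₀ j)).comp
      (hAl.prodMk_nhds (hel' j))
  have hin : ∀ i j, Tendsto (fun k => inner ℂ (e (φ k) i) (A (φ k) (e (φ k) j))) atTop
      (𝓝 (inner ℂ (e₀ i) (A₀ (e₀ j)))) := fun i j => (hel' i).inner (hAel j)
  refine ⟨z₀, IsFrame.isAdmissible (e := e₀) ⟨?_, ?_, ?_, ?_, ?_⟩, φ, hφ, hzl⟩
  · intro i j
    refine tendsto_nhds_unique ((hel' i).inner (hel' j)) ?_
    simp only [(he _).1 i j]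
    exact tendsto_const_nhds
  · intro j
    refine tendsto_nhds_unique (hAel j) ?_
    refine Tendsto.congr (fun k => ((he (φ k)).2.1 j).symm) ?_
    exact tendsto_finsetSum _ fun i _ => (hin i j).smul (hel' i)
  · intro a
    refine ge_of_tendsto' (x := atTop) ?_ fun k => (he (φ k)).2.2.1 a
    exact (hq.tendsto _).comp (tendsto_finsetSum _ fun i _ => (hel' i).const_smul (a i))
  · intro w
    have h1 : Tendsto (fun k => Matrix.of fun i j => inner ℂ (e (φ k) i) (A (φ k) (e (φ k) j)))
        atTop (𝓝 (Matrix.of fun i j => inner ℂ (e₀ i) (A₀ (e₀ j)))) :=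
      tendsto_pi_nhds.mpr fun i => tendsto_pi_nhds.mpr fun j => hin i j
    have h2 : Continuous fun M : Matrix (Fin n) (Fin n) ℂ => (Matrix.scalar (Fin n) w - M).det :=
      (continuous_const.sub continuous_id).matrix_det
    refine tendsto_nhds_unique ((h2.tendsto _).comp h1) ?_
    refine Tendsto.congr (fun k => ((he (φ k)).2.2.2.1 w).symm) ?_
    exact tendsto_finsetProd _ fun i _ => tendsto_const_nhds.sub (hzl' i)
  · intro i
    exact ge_of_tendsto' (hzl' i).norm fun k => (he (φ k)).2.2.2.2 i

end Closed

/-! ### Existence of admissible subspaces, by perturbation to strictly expanding maps. -/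

section Strict

variable {W : Type*} [NormedAddCommGroup W] [InnerProductSpace ℂ W] [FiniteDimensional ℂ W]
  [Module ℝ W] [IsScalarTower ℝ ℂ W]

theorem real_smul_eq {W : Type*} [AddCommGroup W] [Module ℂ W] [Module ℝ W] [IsScalarTower ℝ ℂ W]
    (r : ℝ) (x : W) : (r : ℂ) • x = r • x := algebraMap_smul ℂ r x

theorem summable_norm_pow_of_mem_maxGenEigenspace {A : End ℂ W} {μ : ℂ} (hμ : ‖μ‖ < 1) {x : W}
    (hx : x ∈ A.maxGenEigenspace μ) : Summable fun k => ‖(A ^ k) x‖ := by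
  rw [mem_maxGenEigenspace] at hx
  obtain ⟨m, hm⟩ := hx
  induction m generalizing x with
  | zero =>
    simp only [pow_zero, Module.End.one_apply] at hm
    simp [hm]
  | succ m ih =>
    set y := (A - μ • (1 : End ℂ W)) x with hy
    have hym : ((A - μ • (1 : End ℂ W)) ^ m) y = 0 := by
      rw [hy, ← Module.End.mul_apply, ← pow_succ, hm]
    have hsum := ih hym
    have hAx : A x = μ • x + y := by simp [hy]
    have hstep : ∀ k, ‖(A ^ (k + 1)) x‖ ≤ ‖μ‖ * ‖(A ^ k) x‖ + ‖(A ^ k) y‖ := by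
      intro k
      rw [pow_succ, Module.End.mul_apply, hAx, map_add, map_smul]
      exact (norm_add_le _ _).trans (by rw [norm_smul])
    -- Summing `hstep` bounds a partial sum $S$ by $S\le\|x\|+\|\mu\|S+\sum_k\|A^ky\|$; the constant
    -- solves this for $S$.
    refine summable_of_sum_range_le (c := (‖x‖ + ∑' k, ‖(A ^ k) y‖) / (1 - ‖μ‖))
      (fun k => norm_nonneg _) fun n => ?_
    rw [le_div_iff₀ (by linarith)]
    have h1 : ∑ k ∈ Finset.range (n + 1), ‖(A ^ k) x‖ ≤
        ‖x‖ + (‖μ‖ * ∑ k ∈ Finset.range n, ‖(A ^ k) x‖ + ∑' k, ‖(A ^ k) y‖) := by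
      rw [Finset.sum_range_succ', add_comm]
      refine add_le_add (by simp) ?_
      refine (Finset.sum_le_sum fun k _ => hstep k).trans ?_
      rw [Finset.sum_add_distrib, ← Finset.mul_sum]
      exact add_le_add le_rfl (hsum.sum_le_tsum _ fun _ _ => norm_nonneg _)
    have h2 : ∑ k ∈ Finset.range n, ‖(A ^ k) x‖ ≤ ∑ k ∈ Finset.range (n + 1), ‖(A ^ k) x‖ := by
      rw [Finset.sum_range_succ]
      linarith [norm_nonneg ((A ^ n) x)]
    nlinarith

theorem tendsto_pow_of_mem_iSup {A : End ℂ W} {x : W}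
    (hx : x ∈ ⨆ (μ : ℂ) (_ : ‖μ‖ < 1), A.maxGenEigenspace μ) :
    Tendsto (fun k => (A ^ k) x) atTop (𝓝 0) := by
  induction hx using Submodule.iSup_induction' with
  | mem μ x hx =>
    by_cases hμ : ‖μ‖ < 1
    · rw [iSup_pos hμ] at hx
      exact tendsto_zero_iff_norm_tendsto_zero.mpr
        (summable_norm_pow_of_mem_maxGenEigenspace hμ hx).tendsto_atTop_zero
    · rw [iSup_neg hμ, Submodule.mem_bot] at hx
      simp [hx]
  | zero => simp
  | add x y _ _ hx hy => simpa using hx.add hy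

theorem maxGenEigenspace_le_of_mul_eq_one {A A' : End ℂ W} (h : A' * A = 1) (h' : A * A' = 1)
    {μ : ℂ} (hμ : μ ≠ 0) : A.maxGenEigenspace μ ≤ A'.maxGenEigenspace μ⁻¹ := by
  intro x hx
  rw [mem_maxGenEigenspace] at hx ⊢
  obtain ⟨k, hk⟩ := hx
  refine ⟨k, ?_⟩
  have e : A' - μ⁻¹ • (1 : End ℂ W) = (-μ⁻¹) • A' * (A - μ • (1 : End ℂ W)) := by
    rw [mul_sub, smul_mul_assoc, h, mul_smul_comm, mul_one, smul_smul, neg_smul, mul_neg,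
      mul_inv_cancel₀ hμ]
    module
  have hc : Commute ((-μ⁻¹) • A') (A - μ • (1 : End ℂ W)) := by
    refine Commute.smul_left (Commute.sub_right (h.trans h'.symm) ?_) _
    exact (Commute.one_right _).smul_right _
  rw [e, hc.mul_pow, Module.End.mul_apply, hk, map_zero]

variable {B : LinearMap.BilinForm ℝ W}

/-- The values of the form increase along the orbit of `x`, which tends to `0`. -/
theorem nonpos_of_expanding (hq : Continuous fun x => B x x) {A : End ℂ W}
    (hA : ∀ x, B x x ≤ B (A x) (A x)) {x : W}
    (hx : x ∈ ⨆ (μ : ℂ) (_ : ‖μ‖ < 1), A.maxGenEigenspace μ) : B x x ≤ 0 := by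
  have h1 : ∀ k, B x x ≤ B ((A ^ k) x) ((A ^ k) x) := by
    intro k
    induction k with
    | zero => simp
    | succ k ih =>
      rw [pow_succ', Module.End.mul_apply]
      exact ih.trans (hA _)
  have h2 := (hq.tendsto _).comp (tendsto_pow_of_mem_iSup hx)
  simpa using ge_of_tendsto' h2 h1

theorem exists_fin_roots {K : Type*} [Field K] [IsAlgClosed K] {p : K[X]} (hp : p.Monic) {n : ℕ}
    (hn : p.natDegree = n) : ∃ z : Fin n → K, p = ∏ i, (X - C (z i)) := by
  have hs : p.Splits := IsAlgClosed.splits p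
  obtain ⟨l, hl⟩ := Quot.exists_rep p.roots
  have hl' : p.roots = (l : Multiset K) := hl.symm
  have hlen : l.length = n := by
    rw [← hn, hs.natDegree_eq_card_roots, hl', Multiset.coe_card]
  subst hlen
  refine ⟨l.get, ?_⟩
  have h1 := hs.eq_prod_roots_of_monic hp
  rw [hl', Multiset.map_coe, Multiset.prod_coe, ← Fin.prod_univ_fun_getElem] at h1
  exact h1

/-- Strict expansion excludes eigenvalues on the circle, so `W` is spanned by the expanding part `N`
and the contracting part `M`. Forward orbits show `M` nonpositive, backward orbits show `N`
nonnegative. Each has at most half the dimension, hence exactly half. -/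
theorem IsKrein.exists_isAdmissible_of_strict (hB : IsKrein B) (hq : Continuous fun x => B x x)
    {A : End ℂ W} (hinj : Function.Injective A)
    (hA : ∀ x, x ≠ 0 → B x x < B (A x) (A x)) {n : ℕ} (hn : 2 * n = finrank ℂ W) :
    ∃ z : Fin n → ℂ, IsAdmissible B A z := by
  obtain ⟨A', h, h'⟩ : ∃ A' : End ℂ W, A' * A = 1 ∧ A * A' = 1 :=
    ⟨_, LinearEquiv.ofInjectiveEndo_left_inv A hinj, LinearEquiv.ofInjectiveEndo_right_inv A hinj⟩
  have hA0 : ∀ x, B x x ≤ B (A x) (A x) := by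
    intro x
    rcases eq_or_ne x 0 with rfl | hx
    · simp
    · exact (hA x hx).le
  set N : Submodule ℂ W := ⨆ (μ : ℂ) (_ : 1 < ‖μ‖), A.maxGenEigenspace μ with hNdef
  set M : Submodule ℂ W := ⨆ (μ : ℂ) (_ : ‖μ‖ < 1), A.maxGenEigenspace μ with hMdef
  have hM : ∀ x ∈ M, B x x ≤ 0 := fun x hx => nonpos_of_expanding hq hA0 hx
  have hNle : N ≤ ⨆ (μ : ℂ) (_ : ‖μ‖ < 1), A'.maxGenEigenspace μ := by
    refine iSup₂_le fun μ hμ => ?_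
    have hμ0 : μ ≠ 0 := by rintro rfl; simp at hμ; linarith
    refine (maxGenEigenspace_le_of_mul_eq_one h h' hμ0).trans ?_
    exact le_iSup₂_of_le (f := fun (μ : ℂ) (_ : ‖μ‖ < 1) => A'.maxGenEigenspace μ) μ⁻¹
      (by rw [norm_inv]; exact inv_lt_one_of_one_lt₀ hμ) le_rfl
  have hN : ∀ x ∈ N, 0 ≤ B x x := by
    intro x hx
    have := nonpos_of_expanding (B := -B) hq.neg (A := A') (by
      intro x
      have h1 := hA0 (A' x)
      rw [← Module.End.mul_apply, h', Module.End.one_apply] at h1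
      simpa using h1) (hNle hx)
    simpa using this
  have hsign : ∀ (μ : ℂ) x, x ≠ 0 → A x = μ • x → B x x < ‖μ‖ ^ 2 * B x x := by
    intro μ x hx hAx
    have h1 := hA x hx
    rw [hAx, hB.smul, smul_smul, mul_comm, Complex.mul_conj, Complex.normSq_eq_norm_sq] at h1
    rwa [real_smul_eq, map_smul, smul_eq_mul] at h1
  have htop : N ⊔ M = ⊤ := by
    rw [eq_top_iff, ← iSup_maxGenEigenspace_eq_top A]
    refine iSup_le fun μ => ?_
    rcases lt_trichotomy ‖μ‖ 1 with hμ | hμ | hμ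
    · exact le_sup_of_le_right (le_iSup₂_of_le
        (f := fun (μ : ℂ) (_ : ‖μ‖ < 1) => A.maxGenEigenspace μ) μ hμ le_rfl)
    · have : A.maxGenEigenspace μ = ⊥ := by
        by_contra hne
        have hev : A.HasEigenvalue μ := HasUnifEigenvalue.lt zero_lt_one hne
        obtain ⟨v, hv⟩ := hev.exists_hasEigenvector
        have := hsign μ v hv.2 hv.apply_eq_smul
        rw [hμ] at this
        linarith
      rw [this]; exact bot_le
    · exact le_sup_of_le_left (le_iSup₂_of_le
        (f := fun (μ : ℂ) (_ : 1 < ‖μ‖) => A.maxGenEigenspace μ) μ hμ le_rfl)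
  have hdN := hB.finrank_le_of_nonneg (N := N.restrictScalars ℝ) hN
  have hdM := hB.finrank_le_of_nonpos (N := M.restrictScalars ℝ) hM
  rw [finrank_real_eq] at hdN hdM
  have hsum := Submodule.finrank_add_le_finrank_add_finrank N M
  rw [htop, finrank_top] at hsum
  have hNn : finrank ℂ N = n := by omega
  have hgN : ∀ x ∈ N, A x ∈ N := by
    intro x hx
    have : N ≤ N.comap A := by
      refine iSup₂_le fun μ hμ => ?_
      intro x hx
      have h1 : A x ∈ A.maxGenEigenspace μ :=
        mapsTo_maxGenEigenspace_of_comm (Commute.refl A) μ hx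
      exact (le_iSup₂_of_le (f := fun (μ : ℂ) (_ : 1 < ‖μ‖) => A.maxGenEigenspace μ) μ hμ
        le_rfl : A.maxGenEigenspace μ ≤ N) h1
    exact this hx
  obtain ⟨z, hz⟩ := exists_fin_roots (LinearMap.charpoly_monic (A.restrict hgN))
    (n := n) (by rw [LinearMap.charpoly_natDegree, hNn])
  refine ⟨z, N, hgN, hN, hNn, hz, fun i => ?_⟩
  have hroot : (A.restrict hgN).charpoly.IsRoot (z i) := by
    rw [hz, IsRoot, eval_prod]
    exact Finset.prod_eq_zero (Finset.mem_univ i) (by simp)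
  rw [← hasEigenvalue_iff_isRoot_charpoly] at hroot
  obtain ⟨v, hv⟩ := hroot.exists_hasEigenvector
  have h1 : A v = z i • (v : W) := congrArg Subtype.val hv.apply_eq_smul
  have h2 : (v : W) ≠ 0 := fun h => hv.2 (Subtype.ext h)
  have h3 := hsign _ _ h2 h1
  have h4 := hN v v.2
  by_contra hlt
  push Not at hlt
  have : ‖z i‖ ^ 2 ≤ 1 := by nlinarith [norm_nonneg (z i)]
  nlinarith

/-- A complex linear operator `J` with `B x (J x) > 0` for all `x ≠ 0`. -/
theorem IsKrein.exists_pos (hB : IsKrein B) :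
    ∃ J : End ℂ W, ∀ x, x ≠ 0 → 0 < B x (J x) := by
  have hI : ∀ x : W, Complex.I • Complex.I • x = -x := by
    intro x; rw [smul_smul, Complex.I_mul_I, neg_smul, one_smul]
  have hre : ∀ (z : ℂ) x y, B (z • x) y = z.re * B x y + z.im * B (Complex.I • x) y := by
    intro z x y
    have : z • x = z.re • x + z.im • Complex.I • x := by
      rw [← real_smul_eq z.re, ← real_smul_eq z.im, smul_smul, ← add_smul, Complex.re_add_im]
    rw [this]
    simp
  -- `h y` is the complex linear functional with real part $B(\cdot,y)$. Taking $J=\sum_i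
  -- h(b_i)(\cdot)\,b_i$ makes $B(x,Jx)=\sum_i|h(b_i)x|^2$.
  let h : W → W →ₗ[ℂ] ℂ := fun y =>
    { toFun := fun x => (B x y : ℂ) - Complex.I * B (Complex.I • x) y
      map_add' := by
        intro a b
        rw [smul_add]
        simp only [map_add, LinearMap.add_apply, Complex.ofReal_add]
        ring
      map_smul' := by
        intro c x
        rw [RingHom.id_apply, smul_eq_mul, smul_comm, hre c x, hre c (Complex.I • x), hI]
        conv_rhs => rw [← Complex.re_add_im c]
        simp only [map_neg, LinearMap.neg_apply]
        push_cast
        linear_combination ((c.im : ℂ) * B (Complex.I • x) y) * Complex.I_sq }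
  set b := finBasis ℂ W
  let J : End ℂ W := ∑ i, (h (b i)).smulRight (b i)
  have hval : ∀ x (c : ℂ) y, B x (c • y) = (starRingEnd ℂ c * h y x).re := by
    intro x c y
    have e1 : B x (c • y) = B (starRingEnd ℂ c • x) y := by rw [hB.smul, Complex.conj_conj]
    rw [e1, hre]
    simp [h]
    ring
  have hJ : ∀ x, B x (J x) = ∑ i, ‖h (b i) x‖ ^ 2 := by
    intro x
    simp only [J, LinearMap.sum_apply, map_sum, LinearMap.smulRight_apply]
    refine Finset.sum_congr rfl fun i _ => ?_
    rw [hval, mul_comm, Complex.mul_conj, Complex.normSq_eq_norm_sq, Complex.ofReal_re]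
  refine ⟨J, fun x hx => ?_⟩
  rw [hJ]
  have h0 : 0 ≤ ∑ i, ‖h (b i) x‖ ^ 2 := Finset.sum_nonneg fun i _ => by positivity
  refine lt_of_le_of_ne h0 fun h1 => hx (hB.nondeg x fun y => ?_)
  have h2 : ∀ i, h (b i) x = 0 := by
    intro i
    have := (Finset.sum_eq_zero_iff_of_nonneg (fun i _ => by positivity)).mp h1.symm i
      (Finset.mem_univ i)
    simpa using this
  rw [← b.sum_repr y, map_sum]
  refine Finset.sum_eq_zero fun i _ => ?_
  rw [hval, h2, mul_zero, Complex.zero_re]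

theorem IsKrein.exists_isAdmissible (hB : IsKrein B) (hq : Continuous fun x => B x x)
    {g : W →L[ℂ] W} (hg : ∀ x y, B (g x) (g y) = B x y) {n : ℕ} (hn : 2 * n = finrank ℂ W) :
    ∃ z : Fin n → ℂ, IsAdmissible B (g : End ℂ W) z := by
  obtain ⟨J₀, hJ₀⟩ := hB.exists_pos
  set J : W →L[ℂ] W := LinearMap.toContinuousLinearMap J₀ with hJdef
  have hJ : ∀ x, x ≠ 0 → 0 < B x (J x) := hJ₀
  have hgi := hB.injective_of_isometry (g := (g : End ℂ W)) hg
  set ε : ℕ → ℝ := fun k => 1 / ((k : ℝ) + 1) with hε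
  have hε0 : Tendsto ε atTop (𝓝 0) := tendsto_one_div_add_atTop_nhds_zero_nat
  have hεpos : ∀ k, 0 < ε k := fun k => by rw [hε]; positivity
  have hP : Tendsto (fun k => (1 : W →L[ℂ] W) + ((ε k : ℝ) : ℂ) • J) atTop (𝓝 1) := by
    have : Continuous fun t : ℝ => (1 : W →L[ℂ] W) + (t : ℂ) • J := by fun_prop
    have h := (this.tendsto 0).comp hε0
    rw [Complex.ofReal_zero, zero_smul, add_zero] at h
    exact h
  have hM : Tendsto (fun k => (1 : W →L[ℂ] W) - ((ε k : ℝ) : ℂ) • J) atTop (𝓝 1) := by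
    have : Continuous fun t : ℝ => (1 : W →L[ℂ] W) - (t : ℂ) • J := by fun_prop
    have h := (this.tendsto 0).comp hε0
    rw [Complex.ofReal_zero, zero_smul, sub_zero] at h
    exact h
  have hU : ∀ᶠ u : W →L[ℂ] W in 𝓝 1, IsUnit u := Units.isOpen.mem_nhds isUnit_one
  -- A Cayley-type perturbation: with $x=y-\varepsilon Jy$ its value is $g(y+\varepsilon Jy)$, so
  -- the form grows by exactly $4\varepsilon B(y,Jy)>0$.
  set A : ℕ → W →L[ℂ] W := fun k =>
    g * ((1 + ((ε k : ℝ) : ℂ) • J) * Ring.inverse (1 - ((ε k : ℝ) : ℂ) • J)) with hAdef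
  have hAlim : Tendsto A atTop (𝓝 g) := by
    have h1 := NormedRing.inverse_continuousAt (1 : (W →L[ℂ] W)ˣ)
    rw [ContinuousAt, Units.val_one] at h1
    have := (hP.mul (h1.comp hM)).const_mul g
    rw [Ring.inverse_one, mul_one, mul_one] at this
    exact this
  have hadm : ∀ᶠ k in atTop, ∃ z : Fin n → ℂ, IsAdmissible B (A k : End ℂ W) z := by
    filter_upwards [hP.eventually hU, hM.eventually hU] with k hk1 hk2
    set u : W →L[ℂ] W := 1 - ((ε k : ℝ) : ℂ) • J with hu
    have huu : ∀ x, u (Ring.inverse u x) = x := fun x =>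
      DFunLike.congr_fun (Ring.mul_inverse_cancel u hk2) x
    have hTinj : Function.Injective
        ((1 + ((ε k : ℝ) : ℂ) • J) * Ring.inverse u : W →L[ℂ] W) := by
      obtain ⟨v, hv⟩ := hk1.mul hk2.ringInverse
      rw [← hv]
      have hl : ∀ x, (↑v⁻¹ : W →L[ℂ] W) ((v : W →L[ℂ] W) x) = x := fun x =>
        DFunLike.congr_fun v.inv_mul x
      exact Function.LeftInverse.injective hl
    refine hB.exists_isAdmissible_of_strict hq (A := (A k : End ℂ W)) (hgi.comp hTinj) ?_ hn
    intro x hx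
    set y := Ring.inverse u x with hy
    have hxy : x = y - ε k • J y := by
      rw [← real_smul_eq]
      exact (huu x).symm
    have hAx : (A k : End ℂ W) x = g (y + ε k • J y) := by
      rw [← real_smul_eq]
      rfl
    have hy0 : y ≠ 0 := by
      intro h
      rw [h, map_zero, smul_zero, sub_zero] at hxy
      exact hx hxy
    have hpos := mul_pos (hεpos k) (hJ y hy0)
    rw [hAx, hg, hxy]
    simp only [map_sub, map_add, map_smul, LinearMap.sub_apply, LinearMap.add_apply,
      LinearMap.smul_apply, smul_eq_mul, hB.symm (J y) y]
    linarith
  obtain ⟨K, hK⟩ := eventually_atTop.mp hadm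
  choose z hz using fun k => hK (k + K) (by omega)
  obtain ⟨z₀, hz₀, -⟩ := IsAdmissible.exists_subseq hq
    (hAlim.comp (tendsto_add_atTop_nat K)) hz
  exact ⟨z₀, hz₀⟩

end Strict

/-! ### Sequential continuity of the circle product. -/

section Abstract

variable {W : Type*} [NormedAddCommGroup W] [InnerProductSpace ℂ W] [FiniteDimensional ℂ W]
  [Module ℝ W] [IsScalarTower ℝ ℂ W]

/-- Every subsequence has a further one along which the chosen eigenvalue lists converge to an
admissible list of the limit. Those eigenvalues have modulus at least `1`, so phases are continuous
there. -/
theorem tendsto_circleProd {f : Circle → Circle} (hf : Continuous f) (hf1 : f 1 = 1)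
    (hfm : f (-1) = 1) (hfinv : ∀ z, f z⁻¹ = (f z)⁻¹)
    {B : LinearMap.BilinForm ℝ W} (hB : IsKrein B) (hq : Continuous fun x => B x x)
    {c : W →ₗ[ℝ] W} (hc : IsConj c) (heven : Even (finrank ℂ W))
    {A : ℕ → W →L[ℂ] W} {A₀ : W →L[ℂ] W} (hA : Tendsto A atTop (𝓝 A₀))
    (hiso : ∀ k x y, B (A k x) (A k y) = B x y) (hiso₀ : ∀ x y, B (A₀ x) (A₀ y) = B x y)
    (hcA : ∀ k x, c (A k x) = A k (c x)) (hcA₀ : ∀ x, c (A₀ x) = A₀ (c x)) :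
    Tendsto (fun k => circleProd f B (A k : End ℂ W)) atTop
      (𝓝 (circleProd f B (A₀ : End ℂ W))) := by
  obtain ⟨n, hn⟩ := heven
  rw [← two_mul] at hn
  have hn := hn.symm
  choose z hz using fun k => hB.exists_isAdmissible hq (hiso k) hn
  refine tendsto_of_subseq_tendsto fun ns hns => ?_
  obtain ⟨z₀, hz₀, φ, hφ, hlim⟩ := IsAdmissible.exists_subseq hq (hA.comp hns)
    (z := z ∘ ns) (fun k => hz (ns k))
  refine ⟨φ, ?_⟩
  rw [circleProd_eq_prod hf1 hfm hfinv hB hc hiso₀ hcA₀ hn hz₀]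
  refine Tendsto.congr (fun k => (circleProd_eq_prod hf1 hfm hfinv hB hc (hiso _) (hcA _) hn
    (hz (ns (φ k)))).symm) ?_
  refine tendsto_finsetProd _ fun i _ => ?_
  have hi : z₀ i ≠ 0 := by
    obtain ⟨_, _, _, _, _, h⟩ := hz₀
    intro h0
    have := h i
    rw [h0, norm_zero] at this
    linarith
  exact (hf.tendsto _).comp ((continuousAt_phase hi).tendsto.comp
    (((continuous_apply i).tendsto _).comp hlim))

end Abstract

/-! ### The complexified symplectic form as a neutral form. -/

section Complexification

variable {V : Type*} [AddCommGroup V] [Module ℝ V]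

theorem conj_tmul (a : ℂ) (v : V) : conj (a ⊗ₜ[ℝ] v) = starRingEnd ℂ a ⊗ₜ[ℝ] v := rfl

theorem kreinForm_tmul (ω : LinearMap.BilinForm ℝ V) (a b : ℂ) (v w : V) :
    kreinForm ω (a ⊗ₜ[ℝ] v) (b ⊗ₜ[ℝ] w) = (a * starRingEnd ℂ b).im * ω v w := by
  change (LinearMap.BilinForm.baseChange ℂ ω (a ⊗ₜ[ℝ] v) (conj (b ⊗ₜ[ℝ] w))).im = _
  rw [conj_tmul, LinearMap.BilinForm.baseChange_tmul]
  simp [mul_comm]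

theorem exists_eq_add (x : ℂ ⊗[ℝ] V) : ∃ v w : V, x = 1 ⊗ₜ[ℝ] v + Complex.I ⊗ₜ[ℝ] w := by
  induction x with
  | zero => exact ⟨0, 0, by simp⟩
  | tmul a v =>
    refine ⟨a.re • v, a.im • v, ?_⟩
    rw [TensorProduct.tmul_smul, TensorProduct.tmul_smul, TensorProduct.smul_tmul',
      TensorProduct.smul_tmul', ← TensorProduct.add_tmul]
    congr 1
    apply Complex.ext <;> simp
  | add x y hx hy =>
    obtain ⟨v, w, rfl⟩ := hx
    obtain ⟨v', w', rfl⟩ := hy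
    exact ⟨v + v', w + w', by rw [TensorProduct.tmul_add, TensorProduct.tmul_add]; abel⟩

theorem isConj_conj : IsConj (conj : ℂ ⊗[ℝ] V →ₗ[ℝ] ℂ ⊗[ℝ] V) where
  smul := by
    intro z x
    induction x with
    | zero => simp
    | tmul a v => simp [TensorProduct.smul_tmul', conj_tmul]
    | add x y hx hy => rw [smul_add, map_add, hx, hy, map_add, smul_add]
  invol := by
    intro x
    induction x with
    | zero => simp
    | tmul a v => simp [conj_tmul]
    | add x y hx hy => rw [map_add, map_add, hx, hy]

theorem conj_baseChange (A : V →ₗ[ℝ] V) (x : ℂ ⊗[ℝ] V) :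
    conj (A.baseChange ℂ x) = A.baseChange ℂ (conj x) := by
  induction x with
  | zero => simp
  | tmul a v => simp [conj_tmul]
  | add x y hx hy => simp only [map_add, hx, hy]

theorem kreinForm_baseChange {V' : Type*} [AddCommGroup V'] [Module ℝ V']
    {ω : LinearMap.BilinForm ℝ V} {ω' : LinearMap.BilinForm ℝ V'} {A : V →ₗ[ℝ] V'}
    (hA : ∀ v w, ω' (A v) (A w) = ω v w) (x y : ℂ ⊗[ℝ] V) :
    kreinForm ω' (A.baseChange ℂ x) (A.baseChange ℂ y) = kreinForm ω x y := by
  induction x with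
  | zero => simp
  | tmul a v =>
    induction y with
    | zero => simp
    | tmul b w =>
      rw [LinearMap.baseChange_tmul, LinearMap.baseChange_tmul, kreinForm_tmul, kreinForm_tmul, hA]
    | add x y hx hy => simp only [map_add, hx, hy]
  | add x y hx hy => simp only [map_add, LinearMap.add_apply, hx, hy]

variable [FiniteDimensional ℝ V]

theorem even_finrank {ω : LinearMap.BilinForm ℝ V} (hω_alt : ω.IsAlt) (hω : ω.Nondegenerate) :
    Even (finrank ℝ V) := by
  by_contra hodd
  rw [Nat.not_even_iff_odd] at hodd
  set b := finBasis ℝ V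
  have hdet := (LinearMap.BilinForm.nondegenerate_iff_det_ne_zero b).mp hω
  have hT : (LinearMap.BilinForm.toMatrix b ω).transpose = -LinearMap.BilinForm.toMatrix b ω := by
    ext i j
    simp only [Matrix.transpose_apply, Matrix.neg_apply, LinearMap.BilinForm.toMatrix_apply]
    rw [hω_alt.neg_eq]
  have h := congrArg Matrix.det hT
  rw [Matrix.det_transpose, Matrix.det_neg, Fintype.card_fin, hodd.neg_one_pow] at h
  apply hdet
  linarith

theorem isKrein_kreinForm {ω : LinearMap.BilinForm ℝ V} (hω_alt : ω.IsAlt)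
    (hω : ω.Nondegenerate) : IsKrein (kreinForm ω) := by
  have hsymm : ∀ x y, kreinForm ω x y = kreinForm ω y x := by
    intro x y
    induction x with
    | zero => simp
    | tmul a v =>
      induction y with
      | zero => simp
      | tmul b w =>
        rw [kreinForm_tmul, kreinForm_tmul, ← hω_alt.neg_eq v w]
        simp only [Complex.mul_im, Complex.conj_re, Complex.conj_im]
        ring
      | add x y hx hy => simp only [map_add, LinearMap.add_apply, hx, hy]
    | add x y hx hy => simp only [map_add, LinearMap.add_apply, hx, hy]
  have hnondeg : ∀ x, (∀ y, kreinForm ω x y = 0) → x = 0 := by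
    intro x hx
    obtain ⟨v, w, rfl⟩ := exists_eq_add x
    have h1 : w = 0 := hω.1 _ fun u => by
      simpa [kreinForm_tmul] using hx (1 ⊗ₜ[ℝ] u)
    have h2 : v = 0 := hω.1 _ fun u => by
      simpa [kreinForm_tmul] using hx (Complex.I ⊗ₜ[ℝ] u)
    simp [h1, h2]
  have hconj : ∀ x y, kreinForm ω (conj x) (conj y) = - kreinForm ω x y := by
    intro x y
    induction x with
    | zero => simp
    | tmul a v =>
      induction y with
      | zero => simp
      | tmul b w =>
        rw [conj_tmul, conj_tmul, kreinForm_tmul, kreinForm_tmul]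
        simp only [Complex.mul_im, Complex.conj_re, Complex.conj_im]
        ring
      | add x y hx hy => simp only [map_add, hx, hy]; ring
    | add x y hx hy => simp only [map_add, LinearMap.add_apply, hx, hy]; ring
  have hrad : (kreinForm ω).toQuadraticMap.radical = ⊥ := by
    rw [eq_bot_iff]
    intro x hx
    rw [QuadraticMap.mem_radical_iff'] at hx
    rw [Submodule.mem_bot]
    refine hnondeg x fun y => ?_
    have e := hx.2 y
    have e0 := hx.1
    rw [LinearMap.BilinMap.toQuadraticMap_apply] at e e0
    rw [LinearMap.BilinMap.toQuadraticMap_apply, map_add, map_add, LinearMap.add_apply,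
      LinearMap.add_apply, hsymm y x, e0] at e
    linarith
  -- Complex conjugation reverses the sign of the form, so both indices of inertia agree.
  have hequiv : QuadraticMap.Equivalent (kreinForm ω).toQuadraticMap
      (-(kreinForm ω).toQuadraticMap) :=
    ⟨{ LinearEquiv.ofInvolutive conj isConj_conj.invol with
       map_app' := by
        intro x
        change -(kreinForm ω (conj x) (conj x)) = kreinForm ω x x
        rw [hconj, neg_neg] }⟩
  have hs := hequiv.sigPos_eq
  rw [sigPos_neg] at hs
  have hsum := QuadraticForm.sigPos_add_sigNeg_add_radical (Q := (kreinForm ω).toQuadraticMap)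
  rw [hrad, finrank_bot, finrank_real_eq' (W := ℂ ⊗[ℝ] V)] at hsum
  refine ⟨hsymm, ?_, hnondeg, by omega, by omega⟩
  intro c x y
  induction x with
  | zero => simp
  | tmul a v =>
    induction y with
    | zero => simp
    | tmul b w =>
      rw [TensorProduct.smul_tmul', TensorProduct.smul_tmul', kreinForm_tmul, kreinForm_tmul]
      simp only [smul_eq_mul, map_mul, Complex.conj_conj]
      ring_nf
    | add x y hx hy => simp only [smul_add, map_add, hx, hy]
  | add x y hx hy => simp only [smul_add, map_add, LinearMap.add_apply, hx, hy]

end Complexification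

/-! ### Continuity of the circle product on symplectic operators. -/

section Continuity

variable {V : Type*} [NormedAddCommGroup V] [NormedSpace ℝ V] [FiniteDimensional ℝ V]

/-- An auxiliary inner product, unrelated to the form, that supplies the norm and the orthonormal
frames. -/
theorem exists_innerProductSpace (W : Type*) [AddCommGroup W] [Module ℂ W]
    [FiniteDimensional ℂ W] : Nonempty (InnerProductSpace.Core ℂ W) := by
  set b := finBasis ℂ W
  let Φ : W ≃ₗ[ℂ] EuclideanSpace ℂ (Fin (finrank ℂ W)) :=
    b.equivFun.trans (WithLp.linearEquiv 2 ℂ _).symm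
  exact ⟨{
    inner := fun x y => inner ℂ (Φ x) (Φ y)
    conj_inner_symm := fun x y => inner_conj_symm _ _
    re_inner_nonneg := fun x => inner_self_nonneg
    add_left := fun x y z => by rw [map_add, inner_add_left]
    smul_left := fun x y r => by rw [map_smul, inner_smul_left]
    definite := fun x h => by
      rw [inner_self_eq_zero] at h
      simpa using h }⟩

theorem continuousOn_circleProd {f : Circle → Circle} (hf : Continuous f) (hf1 : f 1 = 1)
    (hfm : f (-1) = 1) (hfinv : ∀ z, f z⁻¹ = (f z)⁻¹)
    {ω : LinearMap.BilinForm ℝ V} (hω_alt : ω.IsAlt) (hω : ω.Nondegenerate) :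
    ContinuousOn (fun A : V →L[ℝ] V => circleProd f (kreinForm ω) ((A : V →ₗ[ℝ] V).baseChange ℂ))
      {A | ∀ v w, ω (A v) (A w) = ω v w} := by
  obtain ⟨core⟩ := exists_innerProductSpace (ℂ ⊗[ℝ] V)
  let : NormedAddCommGroup (ℂ ⊗[ℝ] V) := core.toNormedAddCommGroup
  let : InnerProductSpace ℂ (ℂ ⊗[ℝ] V) := InnerProductSpace.ofCore core.toCore
  rw [continuousOn_iff_continuous_domRestrict]
  refine SeqContinuous.continuous fun A A₀ hA => ?_
  have hB := isKrein_kreinForm hω_alt hω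
  let Φ : (V →L[ℝ] V) →ₗ[ℝ] (ℂ ⊗[ℝ] V →L[ℂ] ℂ ⊗[ℝ] V) :=
    { toFun := fun A => LinearMap.toContinuousLinearMap ((A : V →ₗ[ℝ] V).baseChange ℂ)
      map_add' := by
        intro A B
        rw [ContinuousLinearMap.toLinearMap_add, LinearMap.baseChange_add, map_add]
      map_smul' := by
        intro r A
        rw [ContinuousLinearMap.toLinearMap_smul, LinearMap.baseChange_smul]
        rfl }
  have hΦ : Continuous Φ := LinearMap.continuous_of_finiteDimensional Φ
  have hq : Continuous fun x => kreinForm ω x x := by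
    have : ContinuousSMul ℝ (ℂ ⊗[ℝ] V) := IsScalarTower.continuousSMul ℂ
    set b := finBasis ℝ (ℂ ⊗[ℝ] V)
    have hb : ∀ i, Continuous (b.coord i) := fun i => LinearMap.continuous_of_finiteDimensional _
    have e : (fun x => kreinForm ω x x) =
        fun x => ∑ i, ∑ j, b.coord i x * (b.coord j x * kreinForm ω (b i) (b j)) := by
      funext x
      conv_lhs => rw [← b.sum_repr x]
      rw [map_sum, Finset.sum_comm]
      refine Finset.sum_congr rfl fun j _ => ?_
      rw [map_smul, map_sum, LinearMap.sum_apply, smul_eq_mul, Finset.mul_sum]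
      refine Finset.sum_congr rfl fun i _ => ?_
      rw [map_smul, LinearMap.smul_apply, smul_eq_mul]
      exact mul_left_comm _ _ _
    rw [e]
    fun_prop
  refine tendsto_circleProd hf hf1 hfm hfinv hB hq isConj_conj ?_
    (A := fun k => Φ (A k).1) (A₀ := Φ A₀.1) ?_ ?_ ?_ ?_ ?_
  · rw [Module.finrank_baseChange]
    exact even_finrank hω_alt hω
  · exact (hΦ.tendsto _).comp ((continuous_subtype_val.tendsto _).comp hA)
  · exact fun k x y => kreinForm_baseChange (A k).2 x y
  · exact fun x y => kreinForm_baseChange A₀.2 x y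
  · exact fun k x => conj_baseChange _ x
  · exact fun x => conj_baseChange _ x

end Continuity

/-! ### Existence and uniqueness of the decomposition of a Lagrangian relation. -/

section Decomposition

variable {V : Type*} [AddCommGroup V] [Module ℝ V] {ω : LinearMap.BilinForm ℝ V}
  {L : Submodule ℝ (V × V)}

/-- `ran L = {w | ∃ v, (v, w) ∈ L}`. -/
def ran (L : Submodule ℝ (V × V)) : Submodule ℝ V := L.map (LinearMap.snd ℝ V V)

theorem mem_ker {v : V} : v ∈ ker L ↔ (v, 0) ∈ L := Iff.rfl

theorem mem_halo {v : V} : v ∈ halo L ↔ (0, v) ∈ L := Iff.rfl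

theorem mem_dom {v : V} : v ∈ dom L ↔ ∃ w, (v, w) ∈ L := by
  simp [dom]

theorem mem_ran {w : V} : w ∈ ran L ↔ ∃ v, (v, w) ∈ L := by
  simp [ran]

theorem IsLagrangian.mem_iff (hL : IsLagrangian ω L) {v w : V} :
    (v, w) ∈ L ↔ ∀ x y, (x, y) ∈ L → ω x v = ω y w := by
  unfold IsLagrangian at hL
  conv_lhs => rw [← hL]
  rw [Submodule.mem_orthogonalBilin_iff]
  constructor
  · intro h x y hxy
    exact sub_eq_zero.mp (h (x, y) hxy)
  · rintro h ⟨x, y⟩ hxy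
    exact sub_eq_zero.mpr (h x y hxy)

theorem IsLagrangian.mem_ker_iff (hL : IsLagrangian ω L) {v : V} :
    v ∈ ker L ↔ ∀ x ∈ dom L, ω x v = 0 := by
  rw [mem_ker, hL.mem_iff]
  simp only [mem_dom, map_zero]
  exact ⟨fun h x ⟨y, hy⟩ => h x y hy, fun h x y hxy => h x ⟨y, hxy⟩⟩

theorem IsLagrangian.mem_halo_iff (hL : IsLagrangian ω L) {v : V} :
    v ∈ halo L ↔ ∀ y ∈ ran L, ω y v = 0 := by
  rw [mem_halo, hL.mem_iff]
  simp only [mem_ran, map_zero]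
  exact ⟨fun h y ⟨x, hx⟩ => (h x y hx).symm, fun h x y hxy => (h y ⟨x, hxy⟩).symm⟩

theorem finrank_map_add_finrank_comap {M M' M'' : Type*} [AddCommGroup M] [Module ℝ M]
    [FiniteDimensional ℝ M] [AddCommGroup M'] [Module ℝ M'] [AddCommGroup M''] [Module ℝ M'']
    (f : M →ₗ[ℝ] M') (g : M'' →ₗ[ℝ] M) (hg : Function.Injective g)
    (hfg : LinearMap.ker f = LinearMap.range g) (N : Submodule ℝ M) :
    finrank ℝ (N.map f) + finrank ℝ (N.comap g) = finrank ℝ N := by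
  have h := LinearMap.finrank_range_add_finrank_ker (f.domRestrict N)
  rw [LinearMap.range_domRestrict] at h
  have e : (N.comap g).map g = (LinearMap.ker (f.domRestrict N)).map N.subtype := by
    rw [Submodule.map_comap_eq, ← hfg, LinearMap.ker_domRestrict, Submodule.map_comap_subtype,
      inf_comm]
  rw [← h, ← Submodule.finrank_map_subtype_eq N (LinearMap.ker (f.domRestrict N)),
    (Submodule.equivMapOfInjective g hg (N.comap g)).finrank_eq, e]

variable [FiniteDimensional ℝ V]

theorem finrank_dom_add_finrank_halo (L : Submodule ℝ (V × V)) :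
    finrank ℝ (dom L) + finrank ℝ (halo L) = finrank ℝ L :=
  finrank_map_add_finrank_comap _ _ LinearMap.inr_injective (LinearMap.range_inr ℝ V V).symm L

theorem finrank_ran_add_finrank_ker (L : Submodule ℝ (V × V)) :
    finrank ℝ (ran L) + finrank ℝ (ker L) = finrank ℝ L :=
  finrank_map_add_finrank_comap _ _ LinearMap.inl_injective (LinearMap.range_inl ℝ V V).symm L

namespace IsLagrangian

variable (hL : IsLagrangian ω L) (hω_alt : ω.IsAlt) (hω : ω.Nondegenerate)
include hL hω_alt hω

theorem mem_dom_iff {x : V} : x ∈ dom L ↔ ∀ k ∈ ker L, ω k x = 0 := by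
  have h1 : ker L = ω.orthogonal (dom L) := by
    ext v
    rw [hL.mem_ker_iff, LinearMap.BilinForm.mem_orthogonal_iff]
  have h2 := LinearMap.BilinForm.orthogonal_orthogonal hω hω_alt.isRefl (dom L)
  rw [← h1] at h2
  rw [← h2, LinearMap.BilinForm.mem_orthogonal_iff]

theorem mem_ran_iff {y : V} : y ∈ ran L ↔ ∀ h ∈ halo L, ω h y = 0 := by
  have h1 : halo L = ω.orthogonal (ran L) := by
    ext v
    rw [hL.mem_halo_iff, LinearMap.BilinForm.mem_orthogonal_iff]
  have h2 := LinearMap.BilinForm.orthogonal_orthogonal hω hω_alt.isRefl (ran L)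
  rw [← h1] at h2
  rw [← h2, LinearMap.BilinForm.mem_orthogonal_iff]

/-- Here $\ker L=(\mathrm{dom}\,L)^\omega$ and $\mathrm{halo}\,L=(\mathrm{ran}\,L)^\omega$. Adding
the two rank counts for the projections gives $2\dim L=2\dim V$. -/
theorem finrank_eq : finrank ℝ L = finrank ℝ V := by
  have h1 : ker L = ω.orthogonal (dom L) := by
    ext v
    rw [hL.mem_ker_iff, LinearMap.BilinForm.mem_orthogonal_iff]
  have h2 : halo L = ω.orthogonal (ran L) := by
    ext v
    rw [hL.mem_halo_iff, LinearMap.BilinForm.mem_orthogonal_iff]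
  have h3 := LinearMap.BilinForm.finrank_orthogonal hω (dom L)
  have h4 := LinearMap.BilinForm.finrank_orthogonal hω (ran L)
  rw [← h1] at h3
  rw [← h2] at h4
  have h5 := finrank_dom_add_finrank_halo L
  have h6 := finrank_ran_add_finrank_ker L
  have h7 := Submodule.finrank_le (dom L)
  have h8 := Submodule.finrank_le (ran L)
  omega

theorem ker_le_dom : ker L ≤ dom L := fun _ hv => mem_dom.mpr ⟨0, hv⟩

theorem halo_le_ran : halo L ≤ ran L := fun _ hv => mem_ran.mpr ⟨0, hv⟩

variable (hH : dom L ⊓ halo L = ⊥)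
include hH

theorem isCompl_dom_halo : IsCompl (dom L) (halo L) := by
  refine Submodule.isCompl_iff_disjoint _ _ ?_ |>.mpr (disjoint_iff.mpr hH)
  rw [finrank_dom_add_finrank_halo, hL.finrank_eq hω_alt hω]

/-- The dual of the previous splitting: a vector of $\mathrm{ran}\,L\cap\ker L$ is
$\omega$-orthogonal to both `halo L` and `dom L`, which span. -/
theorem isCompl_ran_ker : IsCompl (ran L) (ker L) := by
  refine Submodule.isCompl_iff_disjoint _ _ ?_ |>.mpr ?_
  · rw [finrank_ran_add_finrank_ker, hL.finrank_eq hω_alt hω]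
  · rw [Submodule.disjoint_def]
    intro v hv1 hv2
    refine hω.2 v fun x => ?_
    have hx : x ∈ dom L ⊔ halo L := by
      rw [(hL.isCompl_dom_halo hω_alt hω hH).sup_eq_top]; trivial
    obtain ⟨d, hd, h, hh, rfl⟩ := Submodule.mem_sup.mp hx
    rw [map_add, LinearMap.add_apply, hL.mem_ker_iff.mp hv2 d hd,
      (hL.mem_ran_iff hω_alt hω).mp hv1 h hh, add_zero]

theorem eq_zero_of_dom_halo {v : V} (h1 : v ∈ dom L) (h2 : v ∈ halo L) : v = 0 :=
  Submodule.disjoint_def.mp (hL.isCompl_dom_halo hω_alt hω hH).disjoint v h1 h2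

theorem eq_zero_of_ran_ker {v : V} (h1 : v ∈ ran L) (h2 : v ∈ ker L) : v = 0 :=
  Submodule.disjoint_def.mp (hL.isCompl_ran_ker hω_alt hω hH).disjoint v h1 h2

theorem exists_dom_halo (x : V) : ∃ d ∈ dom L, ∃ h ∈ halo L, d + h = x :=
  Submodule.mem_sup.mp (by rw [(hL.isCompl_dom_halo hω_alt hω hH).sup_eq_top]; trivial)

theorem exists_ran_ker (x : V) : ∃ r ∈ ran L, ∃ k ∈ ker L, r + k = x :=
  Submodule.mem_sup.mp (by rw [(hL.isCompl_ran_ker hω_alt hω hH).sup_eq_top]; trivial)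

theorem eq_zero_of_mem_sup {x k h : V} (hx1 : x ∈ dom L) (hk : k ∈ ker L) (hh : h ∈ halo L)
    (hx : k + h = x) : h = 0 := by
  refine hL.eq_zero_of_dom_halo hω_alt hω hH ?_ hh
  have : h = x - k := by rw [← hx]; abel
  rw [this]
  exact (dom L).sub_mem hx1 (hL.ker_le_dom hω_alt hω hk)

theorem eq_zero_of_mem_sup' {x k h : V} (hx1 : x ∈ ran L) (hk : k ∈ ker L) (hh : h ∈ halo L)
    (hx : k + h = x) : k = 0 := by
  refine hL.eq_zero_of_ran_ker hω_alt hω hH ?_ hk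
  have : k = x - h := by rw [← hx]; abel
  rw [this]
  exact (ran L).sub_mem hx1 (hL.halo_le_ran hω_alt hω hh)

theorem isCompl_sup_inf : IsCompl (ker L ⊔ halo L) (dom L ⊓ ran L) := by
  constructor
  · rw [Submodule.disjoint_def]
    rintro x hx ⟨hx1, hx2⟩
    obtain ⟨k, hk, h, hh, hkh⟩ := Submodule.mem_sup.mp hx
    rw [← hkh, hL.eq_zero_of_mem_sup hω_alt hω hH hx1 hk hh hkh,
      hL.eq_zero_of_mem_sup' hω_alt hω hH hx2 hk hh hkh, add_zero]
  · rw [codisjoint_iff, eq_top_iff]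
    intro x _
    obtain ⟨d, hd, h, hh, rfl⟩ := hL.exists_dom_halo hω_alt hω hH x
    obtain ⟨r, hr, k, hk, rfl⟩ := hL.exists_ran_ker hω_alt hω hH d
    have hrd : r ∈ dom L := by
      have := (dom L).sub_mem hd (hL.ker_le_dom hω_alt hω hk)
      rwa [add_sub_cancel_right] at this
    rw [show r + k + h = (k + h) + r by abel]
    exact Submodule.add_mem_sup (Submodule.add_mem_sup hk hh) ⟨hrd, hr⟩

/-- Any image of `v` can be moved into `dom L` by removing its `halo L` component, and two such
images differ by an element of $\mathrm{dom}\,L\cap\mathrm{halo}\,L$. -/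
theorem existsUnique_mem (v : ↥(dom L ⊓ ran L)) :
    ∃! w : ↥(dom L ⊓ ran L), ((v : V), (w : V)) ∈ L := by
  obtain ⟨y, hy⟩ := mem_dom.mp v.2.1
  obtain ⟨d, hd, h, hh, rfl⟩ := hL.exists_dom_halo hω_alt hω hH y
  have hvd : ((v : V), d) ∈ L := by
    have := L.sub_mem hy (mem_halo.mp hh)
    simpa using this
  refine ⟨⟨d, hd, mem_ran.mpr ⟨v, hvd⟩⟩, hvd, fun w hw => Subtype.ext ?_⟩
  refine sub_eq_zero.mp (hL.eq_zero_of_dom_halo hω_alt hω hH ((dom L).sub_mem w.2.1 hd) ?_)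
  rw [mem_halo]
  simpa using L.sub_mem hw hvd

/-- The endomorphism of `dom L ⊓ ran L` whose graph lies in `L`. -/
theorem exists_graph_endo : ∃ φ : ↥(dom L ⊓ ran L) →ₗ[ℝ] ↥(dom L ⊓ ran L),
    ∀ v : ↥(dom L ⊓ ran L), ((v : V), (φ v : V)) ∈ L := by
  choose φ hφ hφ' using hL.existsUnique_mem hω_alt hω hH
  refine ⟨{ toFun := φ, map_add' := ?_, map_smul' := ?_ }, hφ⟩
  · intro a b
    exact (hφ' (a + b) (φ a + φ b) (L.add_mem (hφ a) (hφ b))).symm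
  · intro r a
    exact (hφ' (r • a) (r • φ a) (L.smul_mem r (hφ a))).symm

theorem exists_graph_sp : ∃ φ : Sp (ω.restrict (dom L ⊓ ran L)),
    ∀ v : ↥(dom L ⊓ ran L), ((v : V), (φ.1 v : V)) ∈ L := by
  obtain ⟨φ, hφ⟩ := hL.exists_graph_endo hω_alt hω hH
  have hinj : Function.Injective φ := by
    rw [injective_iff_map_eq_zero]
    intro v hv
    have h1 := hφ v
    rw [hv] at h1
    exact Subtype.ext (hL.eq_zero_of_ran_ker hω_alt hω hH v.2.2 h1)
  refine ⟨⟨LinearEquiv.ofInjectiveEndo φ hinj, fun v w => ?_⟩, hφ⟩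
  exact (hL.mem_iff.mp (hφ w) _ _ (hφ v)).symm

end IsLagrangian

theorem restrict_nondegenerate_of_isCompl (hω : ω.Nondegenerate) (hω_alt : ω.IsAlt)
    {P Q : Submodule ℝ V} (hPQ : IsCompl P Q) (horth : ∀ x ∈ P, ∀ y ∈ Q, ω x y = 0) :
    (ω.restrict P).Nondegenerate := by
  have key : ∀ x : P, (∀ y : P, ω x y = 0) → x = 0 := by
    intro x hx
    refine Subtype.ext (hω.1 _ fun v => ?_)
    have hv : v ∈ P ⊔ Q := by rw [hPQ.sup_eq_top]; trivial
    obtain ⟨p, hp, q, hq, rfl⟩ := Submodule.mem_sup.mp hv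
    rw [map_add, hx ⟨p, hp⟩, horth x x.2 q hq, add_zero]
  refine ⟨key, fun y hy => key y fun x => ?_⟩
  have : ω x y = 0 := hy x
  rw [← hω_alt.neg_eq, this, neg_zero]

theorem IsLagrangian.nonempty_graphDecomposition (hL : IsLagrangian ω L) (hω_alt : ω.IsAlt)
    (hω : ω.Nondegenerate) (hH : dom L ⊓ halo L = ⊥) : Nonempty (GraphDecomposition ω L) := by
  obtain ⟨φ, hφ⟩ := hL.exists_graph_sp hω_alt hω hH
  have hcompl := hL.isCompl_sup_inf hω_alt hω hH
  have horth : ∀ x ∈ ker L ⊔ halo L, ∀ y ∈ dom L ⊓ ran L, ω x y = 0 := by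
    rintro x hx y ⟨hy1, hy2⟩
    obtain ⟨k, hk, h, hh, rfl⟩ := Submodule.mem_sup.mp hx
    rw [map_add, LinearMap.add_apply, (hL.mem_dom_iff hω_alt hω).mp hy1 k hk,
      (hL.mem_ran_iff hω_alt hω).mp hy2 h hh, add_zero]
  refine ⟨{
    Vs := ker L ⊔ halo L
    Vg := dom L ⊓ ran L
    isCompl := hcompl
    orthogonal := horth
    nondegenerate_Vs := restrict_nondegenerate_of_isCompl hω hω_alt hcompl horth
    nondegenerate_Vg := restrict_nondegenerate_of_isCompl hω hω_alt hcompl.symm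
      fun x hx y hy => by rw [← hω_alt.neg_eq, horth y hy x hx, neg_zero]
    φ := φ
    ker_lagrangian := ?_
    halo_lagrangian := ?_
    transverse := ?_
    eq_sum := ?_ }⟩
  · ext x
    rw [Submodule.mem_inf, Submodule.mem_orthogonalBilin_iff]
    constructor
    · rintro ⟨hx1, hx2⟩
      have hxd := (hL.mem_dom_iff hω_alt hω).mpr hx2
      obtain ⟨k, hk, h, hh, hkh⟩ := Submodule.mem_sup.mp hx1
      rw [← hkh, hL.eq_zero_of_mem_sup hω_alt hω hH hxd hk hh hkh, add_zero]
      exact hk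
    · intro hx
      exact ⟨Submodule.mem_sup_left hx,
        (hL.mem_dom_iff hω_alt hω).mp (hL.ker_le_dom hω_alt hω hx)⟩
  · ext x
    rw [Submodule.mem_inf, Submodule.mem_orthogonalBilin_iff]
    constructor
    · rintro ⟨hx1, hx2⟩
      have hxr := (hL.mem_ran_iff hω_alt hω).mpr hx2
      obtain ⟨k, hk, h, hh, hkh⟩ := Submodule.mem_sup.mp hx1
      rw [← hkh, hL.eq_zero_of_mem_sup' hω_alt hω hH hxr hk hh hkh, zero_add]
      exact hh
    · intro hx
      exact ⟨Submodule.mem_sup_right hx,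
        (hL.mem_ran_iff hω_alt hω).mp (hL.halo_le_ran hω_alt hω hx)⟩
  · rw [eq_bot_iff]
    rintro x ⟨hx1, hx2⟩
    exact hL.eq_zero_of_dom_halo hω_alt hω hH (hL.ker_le_dom hω_alt hω hx1) hx2
  · refine le_antisymm ?_ ?_
    · rintro ⟨x, y⟩ hxy
      have hx : x ∈ dom L := mem_dom.mpr ⟨y, hxy⟩
      obtain ⟨r, hr, k, hk, rfl⟩ := hL.exists_ran_ker hω_alt hω hH x
      have hrd : r ∈ dom L := by
        have := (dom L).sub_mem hx (hL.ker_le_dom hω_alt hω hk)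
        rwa [add_sub_cancel_right] at this
      have hφr := hφ ⟨r, hrd, hr⟩
      set w : V := ((φ.1 ⟨r, hrd, hr⟩ : ↥(dom L ⊓ ran L)) : V) with hw
      have hyw : (0, y - w) ∈ L := by
        have := L.sub_mem (L.sub_mem hxy (mem_ker.mp hk)) hφr
        simpa using this
      have e : (r + k, y) = (k, 0) + (0, y - w) + (r, w) := by
        simp [add_comm]
      rw [e]
      refine Submodule.add_mem_sup (Submodule.add_mem_sup ⟨hk, Submodule.zero_mem _⟩
        ⟨Submodule.zero_mem _, hyw⟩) ?_
      refine ⟨(⟨r, hrd, hr⟩, φ.1 ⟨r, hrd, hr⟩), ?_, rfl⟩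
      rw [SetLike.mem_coe, graph, LinearMap.mem_graph_iff]
      rfl
    · refine sup_le (sup_le ?_ ?_) ?_
      · rintro ⟨x, y⟩ ⟨hx, hy⟩
        obtain rfl : y = 0 := hy
        exact hx
      · rintro ⟨x, y⟩ ⟨hx, hy⟩
        obtain rfl : x = 0 := hx
        exact hy
      · rintro _ ⟨⟨v, w⟩, hvw, rfl⟩
        rw [SetLike.mem_coe, graph, LinearMap.mem_graph_iff] at hvw
        have : w = φ.1 v := hvw
        rw [this]
        exact hφ v

namespace GraphDecomposition

variable (D : GraphDecomposition ω L)
include D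

theorem graph_mem (v : D.Vg) : ((v : V), (D.φ.1 v : V)) ∈ L := by
  have : ((v : V), (D.φ.1 v : V)) ∈ (graph D.φ.1).map (D.Vg.subtype.prodMap D.Vg.subtype) := by
    refine ⟨(v, D.φ.1 v), ?_, rfl⟩
    rw [SetLike.mem_coe, graph, LinearMap.mem_graph_iff]
    rfl
  have h2 := D.eq_sum.ge (Submodule.mem_sup_right this)
  exact h2

theorem ker_le : ker L ≤ D.Vs := fun _ hx => (D.ker_lagrangian.ge hx).1

theorem halo_le : halo L ≤ D.Vs := fun _ hx => (D.halo_lagrangian.ge hx).1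

variable (hL : IsLagrangian ω L) (hω_alt : ω.IsAlt) (hω : ω.Nondegenerate)
  (hH : dom L ⊓ halo L = ⊥)
include hL hω_alt hω hH

/-- In a decomposition, a vector of `Vs` loses its `halo L` component to become an element of `dom
L`, hence orthogonal to `ker L`; the Lagrangian condition puts it in `ker L`. -/
theorem Vs_eq : D.Vs = ker L ⊔ halo L := by
  refine le_antisymm ?_ (sup_le D.ker_le D.halo_le)
  intro x hx
  obtain ⟨d, hd, h, hh, rfl⟩ := hL.exists_dom_halo hω_alt hω hH x
  have hdV : d ∈ D.Vs := by
    have := D.Vs.sub_mem hx (D.halo_le hh)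
    rwa [add_sub_cancel_right] at this
  refine Submodule.add_mem_sup ?_ hh
  rw [← D.ker_lagrangian]
  exact ⟨hdV, (Submodule.mem_orthogonalBilin_iff).mpr ((hL.mem_dom_iff hω_alt hω).mp hd)⟩

theorem Vg_eq : D.Vg = dom L ⊓ ran L := by
  have hle : D.Vg ≤ dom L ⊓ ran L := by
    intro y hy
    exact ⟨(hL.mem_dom_iff hω_alt hω).mpr fun k hk => D.orthogonal k (D.ker_le hk) y hy,
      (hL.mem_ran_iff hω_alt hω).mpr fun h hh => D.orthogonal h (D.halo_le hh) y hy⟩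
  have hc := hL.isCompl_sup_inf hω_alt hω hH
  rw [← D.Vs_eq hL hω_alt hω hH] at hc
  refine le_antisymm hle fun y hy => ?_
  have hyt : y ∈ D.Vs ⊔ D.Vg := by rw [D.isCompl.sup_eq_top]; trivial
  obtain ⟨s, hs, g, hg, rfl⟩ := Submodule.mem_sup.mp hyt
  have : s ∈ dom L ⊓ ran L := by
    have := (dom L ⊓ ran L).sub_mem hy (hle hg)
    rwa [add_sub_cancel_right] at this
  rw [Submodule.disjoint_def.mp hc.disjoint s hs this, zero_add]
  exact hg

omit D in
theorem eq (D D' : GraphDecomposition ω L) : D = D' := by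
  have h1 : D.Vs = D'.Vs := (D.Vs_eq hL hω_alt hω hH).trans (D'.Vs_eq hL hω_alt hω hH).symm
  have h2 : D.Vg = D'.Vg := (D.Vg_eq hL hω_alt hω hH).trans (D'.Vg_eq hL hω_alt hω hH).symm
  have h3 : ∀ (v : V) (hv : v ∈ D.Vg) (hv' : v ∈ D'.Vg),
      (D.φ.1 ⟨v, hv⟩ : V) = D'.φ.1 ⟨v, hv'⟩ := by
    intro v hv hv'
    refine sub_eq_zero.mp (hL.eq_zero_of_dom_halo hω_alt hω hH ?_ (mem_halo.mpr ?_))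
    · have hle : D.Vg ≤ dom L := (D.Vg_eq hL hω_alt hω hH).trans_le inf_le_left
      exact (dom L).sub_mem (hle (D.φ.1 ⟨v, hv⟩).2) (hle (h2.ge (D'.φ.1 ⟨v, hv'⟩).2))
    · simpa using L.sub_mem (D.graph_mem ⟨v, hv⟩) (D'.graph_mem ⟨v, hv'⟩)
  obtain ⟨Vs, Vg, a1, a2, a3, a4, φ, a5, a6, a7, a8⟩ := D
  obtain ⟨Vs', Vg', b1, b2, b3, b4, φ', b5, b6, b7, b8⟩ := D'
  simp only at h1 h2
  subst h1 h2
  have : φ = φ' := by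
    refine Subtype.ext (LinearEquiv.ext fun v => Subtype.ext ?_)
    exact h3 v v.2 v.2
  subst this
  rfl

end GraphDecomposition

end Decomposition

/-! ### Spectral comparison of $\phi_L$ with the transform $\psi$ of `L`. -/

section Mobius

theorem mem_range_of_mem_maxGenEigenspace {K M : Type*} [Field K] [AddCommGroup M] [Module K M]
    [FiniteDimensional K M] {g T : End K M} (hT : Commute g T) {ν : K}
    (hinj : ∀ z ∈ g.maxGenEigenspace ν, T z = 0 → z = 0) {z : M}
    (hz : z ∈ g.maxGenEigenspace ν) : ∃ z', T z' = z := by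
  have hmaps : ∀ x ∈ g.maxGenEigenspace ν, T x ∈ g.maxGenEigenspace ν := fun x hx =>
    mapsTo_maxGenEigenspace_of_comm hT ν hx
  have hs : Function.Surjective (T.restrict hmaps) := by
    refine LinearMap.surjective_of_injective ?_
    rw [injective_iff_map_eq_zero]
    intro x hx
    exact Subtype.ext (hinj x x.2 (congrArg Subtype.val hx))
  obtain ⟨w, hw⟩ := hs ⟨z, hz⟩
  exact ⟨w, congrArg Subtype.val hw⟩

theorem eq_zero_of_mem_maxGenEigenspace {K M : Type*} [Field K] [AddCommGroup M] [Module K M]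
    {g : End K M} {ν s : K} (hs : s ≠ ν) {z : M} (hz : z ∈ g.maxGenEigenspace ν)
    (h : g z = s • z) : z = 0 := by
  have hd : Disjoint (g.genEigenspace s ⊤) (g.genEigenspace ν ⊤) := disjoint_genEigenspace g hs ⊤ ⊤
  refine Submodule.disjoint_def.mp hd z ?_ hz
  exact eigenspace_le_maxGenEigenspace (mem_eigenspace_iff.mpr h)

variable {V : Type*} [AddCommGroup V] [Module ℝ V] [FiniteDimensional ℝ V]
  {ω : LinearMap.BilinForm ℝ V} {L : Submodule ℝ (V × V)}

namespace GraphDecomposition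

variable (D : GraphDecomposition ω L)

/-- The linear map underlying `D.φ`. -/
abbrev endo : End ℝ D.Vg := (D.φ.1 : D.Vg →ₗ[ℝ] D.Vg)

/-- The inclusion of the complexification of `D.Vg`. -/
abbrev incl : ℂ ⊗[ℝ] D.Vg →ₗ[ℂ] ℂ ⊗[ℝ] V := D.Vg.subtype.baseChange ℂ

theorem incl_injective : Function.Injective D.incl := by
  obtain ⟨p, hp⟩ := D.Vg.subtype.exists_leftInverse_of_injective D.Vg.ker_subtype
  refine Function.LeftInverse.injective (g := p.baseChange ℂ) fun x => ?_
  rw [← LinearMap.comp_apply, ← LinearMap.baseChange_comp, hp, LinearMap.baseChange_id]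
  rfl

variable {ψ : End ℝ V} {s : ℝ} (hs : |s| < 1) (hψ : ∀ x y, (x, y) ∈ L → ψ (x + s • y) = s • x + y)
include hs hψ

/-- If $v+s\phi v=0$, applying $\psi$ gives $sv+\phi v=0$; hence $(1-s^2)\phi v=0$. -/
theorem isUnit_one_add : IsUnit (1 + s • D.endo) := by
  have hinj : Function.Injective (1 + s • D.endo : End ℝ D.Vg) := by
    rw [injective_iff_map_eq_zero]
    intro v hv
    have h1 := hψ _ _ (D.graph_mem v)
    have h2 : (v : V) + s • (D.φ.1 v : V) = 0 := congrArg Subtype.val hv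
    rw [h2, map_zero] at h1
    have h3 : (v : V) = -(s • (D.φ.1 v : V)) := eq_neg_of_add_eq_zero_left h2
    rw [h3] at h1
    have h4 : (1 - s * s) • (D.φ.1 v : V) = 0 := by
      rw [sub_smul, one_smul, mul_smul, h1]; module
    have h5 : (1 - s * s) ≠ 0 := by
      have := abs_lt.mp hs
      nlinarith
    have h6 : D.φ.1 v = 0 := Subtype.ext ((smul_eq_zero.mp h4).resolve_left h5)
    simpa using h6
  exact ⟨⟨_, _, LinearEquiv.ofInjectiveEndo_right_inv _ hinj,
    LinearEquiv.ofInjectiveEndo_left_inv _ hinj⟩, rfl⟩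

theorem map_incl (x : ℂ ⊗[ℝ] D.Vg) :
    ψ.baseChange ℂ (D.incl (x + (s : ℂ) • D.endo.baseChange ℂ x)) =
      D.incl ((s : ℂ) • x + D.endo.baseChange ℂ x) := by
  rw [real_smul_eq, real_smul_eq]
  induction x with
  | zero => simp
  | tmul a v =>
    have h := hψ _ _ (D.graph_mem v)
    simp only [incl, LinearMap.baseChange_tmul, ← TensorProduct.tmul_smul,
      ← TensorProduct.tmul_add]
    congr 1
  | add x y hx hy =>
    have e1 : x + y + s • D.endo.baseChange ℂ (x + y) =
        (x + s • D.endo.baseChange ℂ x) + (y + s • D.endo.baseChange ℂ y) := by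
      rw [map_add, smul_add]; abel
    have e2 : s • (x + y) + D.endo.baseChange ℂ (x + y) =
        (s • x + D.endo.baseChange ℂ x) + (s • y + D.endo.baseChange ℂ y) := by
      rw [map_add, smul_add]; abel
    rw [e1, e2, D.incl.map_add, map_add, hx, hy, ← D.incl.map_add]

/-- With $\iota$ the inclusion, $(\psi-\nu)\,\iota\,(1+s\phi)=(1-s\nu)\,\iota\,(\phi-\mu)$. Since
$1+s\phi$ is invertible and commutes with $\phi-\mu$, this iterates to powers and matches the
kernels. -/
theorem incl_mem_iff {μ ν : ℂ} (hμν : ν - s = μ * (1 - s * ν)) (hν : 1 - s * ν ≠ 0)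
    (x : ℂ ⊗[ℝ] D.Vg) :
    D.incl x ∈ maxGenEigenspace (ψ.baseChange ℂ) ν ↔
      x ∈ maxGenEigenspace (D.endo.baseChange ℂ) μ := by
  set φC : End ℂ (ℂ ⊗[ℝ] D.Vg) := D.endo.baseChange ℂ with hφC
  set ψC : End ℂ (ℂ ⊗[ℝ] V) := ψ.baseChange ℂ with hψC
  set P : End ℂ (ℂ ⊗[ℝ] D.Vg) := 1 + (s : ℂ) • φC with hP
  set N : End ℂ (ℂ ⊗[ℝ] D.Vg) := φC - μ • (1 : End ℂ (ℂ ⊗[ℝ] D.Vg)) with hN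
  have hPu : IsUnit P := by
    have h := (D.isUnit_one_add hs hψ).map (Module.End.baseChangeHom ℝ ℂ D.Vg)
    convert h
    rw [map_add, map_one, map_smul, hP]
    congr 1
  have hcomm : Commute P N := by
    refine Commute.sub_right ?_ ((Commute.one_right _).smul_right _)
    exact (Commute.one_left _).add_left ((Commute.refl _).smul_left _)
  have hstep : ∀ x, (ψC - ν • (1 : End ℂ (ℂ ⊗[ℝ] V))) (D.incl (P x)) =
      (1 - s * ν) • D.incl (N x) := by
    intro x
    have e1 : P x = x + (s : ℂ) • φC x := rfl
    have e2 : N x = φC x - μ • x := rfl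
    have e3 : (ψC - ν • (1 : End ℂ (ℂ ⊗[ℝ] V))) (D.incl (P x)) =
      ψC (D.incl (P x)) - ν • D.incl (P x) := rfl
    have e4 : (s : ℂ) - ν = -(μ * (1 - s * ν)) := by rw [← hμν]; ring
    rw [e3, e1, D.map_incl hs hψ, e2]
    simp only [map_add, map_sub, map_smul]
    have : (s : ℂ) • D.incl x + D.incl (φC x) - ν • (D.incl x + (s : ℂ) • D.incl (φC x)) =
        ((s : ℂ) - ν) • D.incl x + (1 - s * ν) • D.incl (φC x) := by module
    rw [this, e4]
    module
  have hpow : ∀ k x, ((ψC - ν • (1 : End ℂ (ℂ ⊗[ℝ] V))) ^ k) (D.incl ((P ^ k) x)) =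
      (1 - s * ν) ^ k • D.incl ((N ^ k) x) := by
    intro k
    induction k with
    | zero => simp
    | succ k ih =>
      intro x
      have e : N ((P ^ k) x) = (P ^ k) (N x) :=
        (DFunLike.congr_fun (hcomm.pow_left k) x).symm
      rw [pow_succ _ k, Module.End.mul_apply, pow_succ' P, Module.End.mul_apply, hstep, map_smul,
        e, ih, smul_smul, pow_succ N, Module.End.mul_apply, pow_succ' (1 - s * ν)]
  have hiff : ∀ k x, ((ψC - ν • (1 : End ℂ (ℂ ⊗[ℝ] V))) ^ k) (D.incl x) = 0 ↔ (N ^ k) x = 0 := by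
    intro k x
    have hPk : IsUnit (P ^ k) := hPu.pow k
    have hbij := (Module.End.isUnit_iff _).mp hPk
    obtain ⟨y, rfl⟩ := hbij.2 x
    have e : (N ^ k) ((P ^ k) y) = (P ^ k) ((N ^ k) y) :=
      (DFunLike.congr_fun (hcomm.pow_pow k k) y).symm
    rw [hpow, e, smul_eq_zero_iff_right (pow_ne_zero _ hν), map_eq_zero_iff _ D.incl_injective,
      map_eq_zero_iff _ hbij.1]
  rw [mem_maxGenEigenspace, mem_maxGenEigenspace]
  exact exists_congr fun k => hiff k x

variable (hL : IsLagrangian ω L) (hω_alt : ω.IsAlt) (hω : ω.Nondegenerate)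
  (hH : dom L ⊓ halo L = ⊥)
include hL hω_alt hω hH

theorem exists_incl_eq {ν : ℂ} (hν : ‖ν‖ = 1) {z : ℂ ⊗[ℝ] V}
    (hz : z ∈ maxGenEigenspace (ψ.baseChange ℂ) ν) : ∃ x, D.incl x = z := by
  -- On `ker L` the map `ψ` is multiplication by `s`; on `halo L` it satisfies `s • ψ h = h`. So `T`
  -- kills both and has image in `Vg`. It is injective on the generalized eigenspace of `ν`, since
  -- neither `s` nor `s⁻¹` lies on the circle.
  set T : End ℝ V := (ψ - s • 1) * (s • ψ - 1) with hT
  have hTa : ∀ v, T v = s • ψ (ψ v) - ψ v - s • (s • ψ v - v) := by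
    intro v
    simp [hT, smul_sub]
  have hTk : ∀ k ∈ ker L, T k = 0 := by
    intro k hk
    have h := hψ _ _ (mem_ker.mp hk)
    rw [smul_zero, add_zero, add_zero] at h
    rw [hTa, h, map_smul, h]
    module
  have hTh : ∀ h ∈ halo L, T h = 0 := by
    intro h hh
    have h1 := hψ _ _ (mem_halo.mp hh)
    rw [smul_zero, zero_add, zero_add, map_smul] at h1
    rw [hTa, ← map_smul, h1]
    module
  have hTg : ∀ v, T v ∈ D.Vg := by
    intro v
    have hψg : ∀ g ∈ D.Vg, ψ g ∈ D.Vg := by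
      intro g hg
      have hbij := (Module.End.isUnit_iff _).mp (D.isUnit_one_add hs hψ)
      obtain ⟨w, hw⟩ := hbij.2 ⟨g, hg⟩
      have h1 : (w : V) + s • (D.φ.1 w : V) = g := congrArg Subtype.val hw
      rw [← h1, hψ _ _ (D.graph_mem w)]
      exact D.Vg.add_mem (D.Vg.smul_mem _ w.2) (D.φ.1 w).2
    have hv : v ∈ D.Vs ⊔ D.Vg := by rw [D.isCompl.sup_eq_top]; trivial
    obtain ⟨x, hx, g, hg, rfl⟩ := Submodule.mem_sup.mp hv
    rw [D.Vs_eq hL hω_alt hω hH] at hx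
    obtain ⟨k, hk, h, hh, rfl⟩ := Submodule.mem_sup.mp hx
    rw [map_add, map_add, hTk k hk, hTh h hh, zero_add, zero_add, hTa]
    exact D.Vg.sub_mem (D.Vg.sub_mem (D.Vg.smul_mem _ (hψg _ (hψg _ hg))) (hψg _ hg))
      (D.Vg.smul_mem _ (D.Vg.sub_mem (D.Vg.smul_mem _ (hψg _ hg)) hg))
  set T' : V →ₗ[ℝ] D.Vg := T.codRestrict D.Vg hTg with hT'
  have hTC : ∀ x, T.baseChange ℂ x = D.incl (T'.baseChange ℂ x) := by
    intro x
    rw [incl, ← LinearMap.comp_apply, ← LinearMap.baseChange_comp]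
    rfl
  have hTC' : ∀ x, T.baseChange ℂ x = (ψ.baseChange ℂ - (s : ℂ) • (1 : End ℂ (ℂ ⊗[ℝ] V)))
      (((s : ℂ) • ψ.baseChange ℂ - 1 : End ℂ (ℂ ⊗[ℝ] V)) x) := by
    intro x
    induction x with
    | zero => simp
    | tmul a v =>
      simp only [LinearMap.baseChange_tmul, LinearMap.sub_apply, LinearMap.smul_apply,
        Module.End.one_apply, real_smul_eq, ← TensorProduct.tmul_smul, ← TensorProduct.tmul_sub]
      congr 1
    | add x y hx hy => rw [map_add, hx, hy, map_add, map_add]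
  have hcomm : Commute (ψ.baseChange ℂ : End ℂ (ℂ ⊗[ℝ] V)) (T.baseChange ℂ) := by
    have h : Commute ψ T := by
      refine Commute.mul_right ?_ ?_
      · exact (Commute.refl _).sub_right ((Commute.one_right _).smul_right _)
      · exact ((Commute.refl _).smul_right _).sub_right (Commute.one_right _)
    exact h.map (Module.End.baseChangeHom ℝ ℂ V)
  have hsν : (s : ℂ) ≠ ν := by
    rintro rfl
    rw [Complex.norm_real, Real.norm_eq_abs] at hν
    linarith
  obtain ⟨z', hz'⟩ := mem_range_of_mem_maxGenEigenspace hcomm (ν := ν) (fun w hw hw0 => by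
    rw [hTC'] at hw0
    set ψC : End ℂ (ℂ ⊗[ℝ] V) := ψ.baseChange ℂ with hψC
    have hmem : ((s : ℂ) • ψC - 1) w ∈ maxGenEigenspace ψC ν := by
      refine mapsTo_maxGenEigenspace_of_comm ?_ ν hw
      exact ((Commute.refl _).smul_right _).sub_right (Commute.one_right _)
    have h1 : ((s : ℂ) • ψC - 1) w = 0 :=
      eq_zero_of_mem_maxGenEigenspace hsν hmem (sub_eq_zero.mp hw0)
    have h2 : (s : ℂ) • ψC w = w := sub_eq_zero.mp h1
    rcases eq_or_ne (s : ℂ) 0 with h0 | h0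
    · rw [← h2, h0, zero_smul]
    · refine eq_zero_of_mem_maxGenEigenspace (s := (s : ℂ)⁻¹) ?_ hw ?_
      · rintro h3
        rw [← h3, norm_inv, Complex.norm_real, Real.norm_eq_abs, inv_eq_one] at hν
        linarith
      · conv_rhs => rw [← h2]
        rw [smul_smul, inv_mul_cancel₀ h0, one_smul]) hz
  exact ⟨_, (hTC z').symm.trans hz'⟩

/-- The indices of inertia of `φ` and of the Möbius transform of `L` correspond. -/
theorem mPlus_eq {μ ν : ℂ} (hν : ‖ν‖ = 1) (hμν : ν - s = μ * (1 - s * ν)) :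
    mPlus ω ψ ν = mPlus (ω.restrict D.Vg) D.endo μ := by
  have hν' : 1 - s * ν ≠ 0 := by
    intro h
    have h1 := congrArg norm (sub_eq_zero.mp h)
    rw [norm_mul, hν, mul_one, norm_one, Complex.norm_real, Real.norm_eq_abs] at h1
    linarith
  have hiff := D.incl_mem_iff hs hψ hμν hν'
  let f : genEigenspace D.endo μ →ₗ[ℝ] genEigenspace ψ ν :=
    (D.incl.restrictScalars ℝ).restrict fun x hx => (hiff x).mpr hx
  have hf : Function.Bijective f := by
    constructor
    · intro x y h
      exact Subtype.ext (D.incl_injective (congrArg Subtype.val h))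
    · rintro ⟨z, hz⟩
      obtain ⟨x, rfl⟩ := D.exists_incl_eq hs hψ hL hω_alt hω hH hν hz
      exact ⟨⟨x, (hiff x).mp hz⟩, rfl⟩
  refine (QuadraticMap.Equivalent.sigPos_eq ⟨{ LinearEquiv.ofBijective f hf with
    map_app' := fun x => ?_ }⟩).symm
  exact kreinForm_baseChange (ω := ω.restrict D.Vg) (ω' := ω) (A := D.Vg.subtype)
    (fun _ _ => rfl) x.1 x.1

end GraphDecomposition

end Mobius

/-! ### Real Möbius transformations of the circle. -/

section CircleMobius

theorem one_sub_mul_ne_zero {s : ℝ} (hs : |s| < 1) (ν : Circle) : (1 : ℂ) - s * ν ≠ 0 := by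
  intro h
  have h1 := congrArg norm (sub_eq_zero.mp h)
  rw [norm_mul, Circle.norm_coe, mul_one, norm_one, Complex.norm_real, Real.norm_eq_abs] at h1
  linarith

/-- The Möbius transformation `ν ↦ (ν - s) / (1 - s ν)` of the unit circle, for real `|s| < 1`. -/
def mobius (s : ℝ) (ν : Circle) : Circle := ν * (phase (1 - s * ν))⁻¹ ^ 2

theorem continuous_mobius {s : ℝ} (hs : |s| < 1) : Continuous (mobius s) := by
  have h : Continuous fun ν : Circle => phase (1 - s * ν) := by
    rw [continuous_iff_continuousAt]
    intro ν
    refine ContinuousAt.comp (f := fun ν : Circle => (1 : ℂ) - s * ν)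
      (continuousAt_phase (one_sub_mul_ne_zero hs ν)) ?_
    fun_prop
  exact continuous_id.mul (h.inv.pow 2)

theorem phase_ofReal_of_pos {r : ℝ} (hr : 0 < r) : phase (r : ℂ) = 1 := by
  rw [phase, Complex.arg_ofReal_of_nonneg hr.le, Circle.exp_zero]

theorem mobius_one {s : ℝ} (hs : |s| < 1) : mobius s 1 = 1 := by
  have := abs_lt.mp hs
  have h : (1 : ℂ) - s * (1 : Circle) = ((1 - s : ℝ) : ℂ) := by simp
  rw [mobius, h, phase_ofReal_of_pos (by linarith)]
  simp

theorem mobius_neg_one {s : ℝ} (hs : |s| < 1) : mobius s (-1) = -1 := by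
  have := abs_lt.mp hs
  have h : (1 : ℂ) - s * (-1 : Circle) = ((1 + s : ℝ) : ℂ) := by simp
  rw [mobius, h, phase_ofReal_of_pos (by linarith)]
  simp

theorem mobius_inv {s : ℝ} (hs : |s| < 1) (ν : Circle) : mobius s ν⁻¹ = (mobius s ν)⁻¹ := by
  have h : (1 : ℂ) - s * (ν⁻¹ : Circle) = starRingEnd ℂ (1 - s * ν) := by
    rw [Circle.coe_inv_eq_conj]; simp
  rw [mobius, mobius, h, phase_conj (one_sub_mul_ne_zero hs ν), mul_inv, inv_pow, inv_pow]

/-- On the circle $\nu-s=\nu\bar w$ with $w=1-s\nu$, and $\bar w/w$ is the inverse square of the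
phase of $w$. -/
theorem mobius_mul {s : ℝ} (hs : |s| < 1) (ν : Circle) :
    (ν : ℂ) - s = mobius s ν * (1 - s * ν) := by
  set w : ℂ := 1 - s * ν with hw
  have hw0 : w ≠ 0 := one_sub_mul_ne_zero hs ν
  have hn : (‖w‖ : ℂ) ≠ 0 := by simpa using hw0
  have h1 : ((mobius s ν : Circle) : ℂ) = ν * (starRingEnd ℂ (w / ‖w‖)) ^ 2 := by
    rw [mobius, Circle.coe_mul, Circle.coe_pow, Circle.coe_inv_eq_conj, ← hw, coe_phase hw0]
  have h2 : starRingEnd ℂ w * w = (‖w‖ : ℂ) ^ 2 := Complex.conj_mul' w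
  have h3 : ((ν : Circle) : ℂ) * starRingEnd ℂ (ν : ℂ) = 1 := by
    rw [Complex.mul_conj, Circle.normSq_coe, Complex.ofReal_one]
  have h4 : starRingEnd ℂ w = 1 - s * starRingEnd ℂ (ν : ℂ) := by simp [hw]
  rw [h1, map_div₀, Complex.conj_ofReal, div_pow]
  have h5 : (ν : ℂ) * (starRingEnd ℂ w ^ 2 / (‖w‖ : ℂ) ^ 2) * w = ν * starRingEnd ℂ w := by
    rw [← h2]
    have : starRingEnd ℂ w ≠ 0 := by simpa using hw0
    field_simp
  rw [h5, h4]
  linear_combination (s : ℂ) * h3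

theorem mobius_neg_mobius {s : ℝ} (hs : |s| < 1) (ν : Circle) : mobius (-s) (mobius s ν) = ν := by
  have hs' : |(-s)| < 1 := by rwa [abs_neg]
  have h1 := mobius_mul hs ν
  have h2 := mobius_mul hs' (mobius s ν)
  have h3 := one_sub_mul_ne_zero hs' (mobius s ν)
  refine Circle.ext (mul_right_cancel₀ h3 ?_)
  rw [← h2]
  push_cast
  linear_combination -h1

/-- The Möbius transformation as a permutation of the circle. -/
def mobiusEquiv {s : ℝ} (hs : |s| < 1) : Circle ≃ Circle where
  toFun := mobius s
  invFun := mobius (-s)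
  left_inv := mobius_neg_mobius hs
  right_inv := by
    intro ν
    have := mobius_neg_mobius (s := -s) (by rwa [abs_neg]) ν
    rwa [neg_neg] at this

theorem mobius_zero (ν : Circle) : mobius 0 ν = ν := by
  have h : (1 : ℂ) - (0 : ℝ) * ν = ((1 : ℝ) : ℂ) := by simp
  rw [mobius, h, phase_ofReal_of_pos one_pos]
  simp

end CircleMobius

/-! ### The squared invariant as a circle product. -/

section RhoSq

variable {V : Type*} [AddCommGroup V] [Module ℝ V] [FiniteDimensional ℝ V]
  {ω : LinearMap.BilinForm ℝ V}

theorem finite_mPlus_ne_zero (ω : LinearMap.BilinForm ℝ V) (A : V →ₗ[ℝ] V) :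
    {μ : Circle | mPlus ω A μ ≠ 0}.Finite := by
  have hfin := Module.End.finite_hasEigenvalue (A.baseChange ℂ : End ℂ (ℂ ⊗[ℝ] V))
  refine (hfin.preimage (f := fun z : Circle => (z : ℂ)) Circle.coe_injective.injOn).subset ?_
  intro μ hμ
  have hne : maxGenEigenspace (A.baseChange ℂ : End ℂ (ℂ ⊗[ℝ] V)) μ ≠ ⊥ := by
    intro h
    apply hμ
    have h1 : finrank ℝ (genEigenspace A μ) = 0 := by
      rw [genEigenspace, finrank_real_eq, h, finrank_bot]
    exact Nat.le_zero.mp (h1 ▸ sigPos_le_finrank _)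
  exact HasUnifEigenvalue.lt zero_lt_one hne

/-- Squaring removes the sign; finiteness of the spectrum lets the square pass through the
`finprod`. -/
theorem rho_sq (A : Sp ω) :
    rho A ^ 2 = circleProd (fun μ => μ ^ 2) (kreinForm ω) ((A.1 : V →ₗ[ℝ] V).baseChange ℂ) := by
  classical
  rw [rho, mul_pow, ← pow_mul, mul_comm (_ / 2) 2, pow_mul, neg_one_sq, one_pow, one_mul]
  have hsup : (Function.mulSupport fun μ : Circle => ∏ᶠ _ : μ ≠ 1 ∧ μ ≠ -1,
      μ ^ (mPlus ω (A.1 : V →ₗ[ℝ] V) μ / 2)).Finite := by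
    refine (finite_mPlus_ne_zero ω (A.1 : V →ₗ[ℝ] V)).subset fun μ hμ h => hμ ?_
    simp only [h, Nat.zero_div, pow_zero, finprod_one]
  rw [finprod_pow hsup]
  refine finprod_congr fun μ => ?_
  rw [finprod_eq_if, finprod_eq_if]
  split_ifs
  · rw [← pow_mul, mul_comm, pow_mul]
    rfl
  · rw [one_pow]

theorem GraphDecomposition.rho_sq_eq {L : Submodule ℝ (V × V)} (D : GraphDecomposition ω L)
    {ψ : End ℝ V} {s : ℝ} (hs : |s| < 1)
    (hψ : ∀ x y, (x, y) ∈ L → ψ (x + s • y) = s • x + y)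
    (hL : IsLagrangian ω L) (hω_alt : ω.IsAlt) (hω : ω.Nondegenerate)
    (hH : dom L ⊓ halo L = ⊥) :
    rho D.φ ^ 2 = circleProd (fun ν => mobius s ν ^ 2) (kreinForm ω) (ψ.baseChange ℂ) := by
  classical
  rw [rho_sq]
  unfold circleProd
  -- The Möbius map permutes the circle and fixes $\pm1$, so the product over eigenvalues of
  -- $\phi_L$ is reindexed by those of `ψ`.
  rw [← finprod_comp_equiv (mobiusEquiv hs)]
  refine finprod_congr fun ν => ?_
  have hiff : ((mobiusEquiv hs ν) ≠ 1 ∧ (mobiusEquiv hs ν) ≠ -1) ↔ (ν ≠ 1 ∧ ν ≠ -1) := by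
    have h1 : mobiusEquiv hs 1 = 1 := mobius_one hs
    have h2 : mobiusEquiv hs (-1) = -1 := mobius_neg_one hs
    have e1 : mobiusEquiv hs ν = 1 ↔ ν = 1 :=
      ⟨fun h => (mobiusEquiv hs).injective (h.trans h1.symm), fun h => h ▸ h1⟩
    have e2 : mobiusEquiv hs ν = -1 ↔ ν = -1 :=
      ⟨fun h => (mobiusEquiv hs).injective (h.trans h2.symm), fun h => h ▸ h2⟩
    rw [ne_eq, ne_eq, e1, e2]
  have hm : mPlus ω ψ ν = mPlus (ω.restrict D.Vg) D.endo (mobius s ν) :=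
    D.mPlus_eq hs hψ hL hω_alt hω hH (Circle.norm_coe ν) (mobius_mul hs ν)
  rw [finprod_eq_if, finprod_eq_if]
  simp only [hiff]
  change (if _ then (mobius s ν ^ 2) ^ (mPlus (ω.restrict D.Vg) D.endo (mobius s ν) / 2) else 1) =
    if _ then (mobius s ν ^ 2) ^ (mPlus ω ψ ν / 2) else 1
  rw [hm]

end RhoSq

/-! ### The transformation $(x,y)\mapsto(x+sy,\,sx+y)$. -/

section Transform

variable {V : Type*} [AddCommGroup V] [Module ℝ V] [FiniteDimensional ℝ V]
  {ω : LinearMap.BilinForm ℝ V} {L : Submodule ℝ (V × V)} {s : ℝ}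

/-- `(x, y) ↦ x + s y` is injective on `L`. -/
def IsRegularAt (s : ℝ) (L : Submodule ℝ (V × V)) : Prop :=
  ∀ x y, (x, y) ∈ L → x + s • y = 0 → x = 0 ∧ y = 0

/-- The transformation multiplies $\pi_1^*\omega-\pi_2^*\omega$ by $1-s^2$, so isotropy of `L`
passes to the graph of `ψ`. -/
theorem isometry_of_transform (hL : IsLagrangian ω L)
    {ψ : End ℝ V} (hsurj : ∀ v, ∃ x y, (x, y) ∈ L ∧ x + s • y = v)
    (hψ : ∀ x y, (x, y) ∈ L → ψ (x + s • y) = s • x + y) (v w : V) :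
    ω (ψ v) (ψ w) = ω v w := by
  obtain ⟨x, y, hxy, rfl⟩ := hsurj v
  obtain ⟨x', y', hxy', rfl⟩ := hsurj w
  rw [hψ _ _ hxy, hψ _ _ hxy']
  have h := hL.mem_iff.mp hxy' x y hxy
  simp only [map_add, map_smul, LinearMap.add_apply, LinearMap.smul_apply, smul_eq_mul, h]
  ring

/-- For $s\neq0$ the singular part never obstructs, since `ker L` and `halo L` are transverse. The
graph part obstructs only when $-1/s$ is an eigenvalue of $\phi_L$, which excludes finitely many
`s`. -/
theorem GraphDecomposition.eventually_isRegularAt (D : GraphDecomposition ω L) :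
    ∀ᶠ s in 𝓝[>] (0 : ℝ), IsRegularAt s L := by
  have hfin := Module.End.finite_hasEigenvalue D.endo
  set S : Set ℝ := {s | s ≠ 0 ∧ D.endo.HasEigenvalue (-s⁻¹)} with hS
  have hSfin : S.Finite := by
    refine (hfin.preimage (f := fun s : ℝ => -s⁻¹)
      (fun a _ b _ h => inv_injective (neg_injective h))).subset ?_
    exact fun s hs => hs.2
  have hS0 : Sᶜ ∈ 𝓝 (0 : ℝ) := hSfin.isClosed.isOpen_compl.mem_nhds fun h => h.1 rfl
  filter_upwards [mem_nhdsWithin_of_mem_nhds hS0, self_mem_nhdsWithin] with s hs hpos x y hxy h0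
  have hs0 : s ≠ 0 := ne_of_gt hpos
  rw [D.eq_sum] at hxy
  obtain ⟨a, ha, b, hb, hab⟩ := Submodule.mem_sup.mp hxy
  obtain ⟨c, hc, d, hd, rfl⟩ := Submodule.mem_sup.mp ha
  obtain ⟨⟨g, g'⟩, hg, rfl⟩ := hb
  rw [SetLike.mem_coe, graph, LinearMap.mem_graph_iff] at hg
  have hg' : g' = D.φ.1 g := hg
  subst hg'
  obtain ⟨k, k'⟩ := c
  obtain ⟨l', l⟩ := d
  obtain ⟨hk, hk'⟩ := hc
  obtain ⟨hl', hl⟩ := hd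
  obtain rfl : k' = 0 := hk'
  obtain rfl : l' = 0 := hl'
  have hx : k + g = x := by simpa using congrArg Prod.fst hab
  have hy : l + D.φ.1 g = y := by simpa using congrArg Prod.snd hab
  subst hx hy
  have hk2 : k ∈ ker L := hk
  have hl2 : l ∈ halo L := hl
  have hVs : k + s • l ∈ D.Vs := D.Vs.add_mem (D.ker_le hk2) (D.Vs.smul_mem _ (D.halo_le hl2))
  have hVg : (g : V) + s • (D.φ.1 g : V) ∈ D.Vg :=
    D.Vg.add_mem g.2 (D.Vg.smul_mem _ (D.φ.1 g).2)
  have hsum : (k + s • l) + ((g : V) + s • (D.φ.1 g : V)) = 0 := by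
    rw [← h0]; module
  have hz : k + s • l = 0 := by
    refine Submodule.disjoint_def.mp D.isCompl.disjoint _ hVs ?_
    rw [eq_neg_of_add_eq_zero_left hsum]
    exact D.Vg.neg_mem hVg
  rw [hz, zero_add] at hsum
  have hl0 : l = 0 := by
    have h1 : k ∈ ker L ⊓ halo L := by
      refine ⟨hk2, ?_⟩
      rw [eq_neg_of_add_eq_zero_left hz]
      exact (halo L).neg_mem ((halo L).smul_mem _ hl2)
    rw [D.transverse, Submodule.mem_bot] at h1
    rw [h1, zero_add] at hz
    exact (smul_eq_zero.mp hz).resolve_left hs0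
  have hk0 : k = 0 := by rw [hl0, smul_zero, add_zero] at hz; exact hz
  have hg0 : g = 0 := by
    by_contra hne
    refine hs ⟨hs0, ?_⟩
    refine Module.End.hasEigenvalue_of_hasEigenvector (x := g) ⟨mem_eigenspace_iff.mpr ?_, hne⟩
    have h1 : g + s • D.φ.1 g = 0 := Subtype.ext hsum
    change D.φ.1 g = -s⁻¹ • g
    conv_rhs => rw [eq_neg_of_add_eq_zero_left h1]
    rw [smul_neg, neg_smul, neg_neg, smul_smul,
      inv_mul_cancel₀ hs0, one_smul]
  rw [hk0, hl0, hg0]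
  simp

end Transform

/-! ### Continuity on the Lagrangian Grassmannian and density of graphs. -/

section Topology

variable {V : Type*} [NormedAddCommGroup V] [NormedSpace ℝ V] [FiniteDimensional ℝ V]
  {ω : LinearMap.BilinForm ℝ V}

/-- The operator mapping the standard basis to a given family. -/
def frameMap : (Fin (finrank ℝ V) → V) →ₗ[ℝ] (V →L[ℝ] V) :=
  (LinearMap.toContinuousLinearMap : (V →ₗ[ℝ] V) ≃ₗ[ℝ] (V →L[ℝ] V)).toLinearMap ∘ₗ
    ((finBasis ℝ V).constr ℝ).toLinearMap

theorem frameMap_basis (u : Fin (finrank ℝ V) → V) (i : Fin (finrank ℝ V)) :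
    frameMap u (finBasis ℝ V i) = u i :=
  (finBasis ℝ V).constr_basis ℝ u i

theorem continuous_frameMap : Continuous (frameMap (V := V)) :=
  LinearMap.continuous_of_finiteDimensional _

theorem isUnit_frameMap_iff (u : Fin (finrank ℝ V) → V) :
    IsUnit (frameMap u) ↔ LinearIndependent ℝ u := by
  constructor
  · rintro ⟨F, hF⟩
    have hinj : Function.Injective (frameMap u) := by
      have hl : ∀ x, (↑F⁻¹ : V →L[ℝ] V) (frameMap u x) = x := fun x => by
        rw [← hF]; exact DFunLike.congr_fun F.inv_mul x
      exact Function.LeftInverse.injective hl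
    have h := (finBasis ℝ V).linearIndependent.map' (frameMap u : V →ₗ[ℝ] V)
      (LinearMap.ker_eq_bot.mpr hinj)
    have e : (frameMap u : V →ₗ[ℝ] V) ∘ finBasis ℝ V = u := funext (frameMap_basis u)
    rwa [e] at h
  · intro h
    set b := basisOfLinearIndependentOfCardEqFinrank' u h (by simp) with hb
    set G : V →L[ℝ] V := LinearMap.toContinuousLinearMap (b.constr ℝ (finBasis ℝ V)) with hG
    have hGb : ∀ i, G (u i) = finBasis ℝ V i := by
      intro i
      have h1 := b.constr_basis ℝ (finBasis ℝ V) i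
      rwa [hb, coe_basisOfLinearIndependentOfCardEqFinrank'] at h1
    have h1 : G * frameMap u = 1 := by
      refine ContinuousLinearMap.coe_injective ((finBasis ℝ V).ext fun i => ?_)
      change G (frameMap u (finBasis ℝ V i)) = finBasis ℝ V i
      rw [frameMap_basis, hGb]
    have h2 : frameMap u * G = 1 := by
      refine ContinuousLinearMap.coe_injective (b.ext fun i => ?_)
      change frameMap u (G (b i)) = b i
      rw [hb, coe_basisOfLinearIndependentOfCardEqFinrank', hGb, frameMap_basis]
    exact ⟨⟨_, _, h2, h1⟩, rfl⟩

variable (ω) in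
theorem continuous_val : Continuous fun b : LagFrame ω => b.1 := continuous_subtype_val

/-- The first components of the transformed frame. -/
def LagFrame.fstVec (s : ℝ) (b : LagFrame ω) : Fin (finrank ℝ V) → V :=
  fun i => (b.1 i).1 + s • (b.1 i).2

/-- The second components of the transformed frame. -/
def LagFrame.sndVec (s : ℝ) (b : LagFrame ω) : Fin (finrank ℝ V) → V :=
  fun i => s • (b.1 i).1 + (b.1 i).2

theorem LagFrame.continuous_fstVec (s : ℝ) : Continuous (LagFrame.fstVec (ω := ω) s) := by
  refine continuous_pi fun i => ?_
  have h : Continuous fun b : LagFrame ω => b.1 i := (continuous_apply i).comp (continuous_val ω)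
  exact h.fst.add (h.snd.const_smul s)

theorem LagFrame.continuous_sndVec (s : ℝ) : Continuous (LagFrame.sndVec (ω := ω) s) := by
  refine continuous_pi fun i => ?_
  have h : Continuous fun b : LagFrame ω => b.1 i := (continuous_apply i).comp (continuous_val ω)
  exact (h.fst.const_smul s).add h.snd

/-- The linear map `(x, y) ↦ x + s y`. -/
def fstMap (V : Type*) [AddCommGroup V] [Module ℝ V] (s : ℝ) : V × V →ₗ[ℝ] V :=
  LinearMap.fst ℝ V V + s • LinearMap.snd ℝ V V

/-- The linear map `(x, y) ↦ s x + y`. -/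
def sndMap (V : Type*) [AddCommGroup V] [Module ℝ V] (s : ℝ) : V × V →ₗ[ℝ] V :=
  s • LinearMap.fst ℝ V V + LinearMap.snd ℝ V V

theorem LagFrame.isUnit_iff (s : ℝ) (b : LagFrame ω) :
    IsUnit (frameMap (b.fstVec s)) ↔ IsRegularAt s b.span.1 := by
  rw [isUnit_frameMap_iff]
  have e : b.fstVec s = fstMap V s ∘ b.1 := rfl
  rw [e]
  constructor
  · intro h x y hxy h0
    obtain ⟨a, ha⟩ := (Submodule.mem_span_range_iff_exists_fun ℝ).mp hxy
    have h1 : fstMap V s (x, y) = 0 := h0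
    rw [← ha, map_sum] at h1
    simp only [map_smul] at h1
    have h2 := Fintype.linearIndependent_iff.mp h a h1
    simp only [h2, zero_smul, Finset.sum_const_zero] at ha
    exact ⟨congrArg Prod.fst ha.symm, congrArg Prod.snd ha.symm⟩
  · intro h
    refine b.2.1.map ?_
    rw [Submodule.disjoint_def]
    rintro ⟨x, y⟩ hxy h0
    obtain ⟨rfl, rfl⟩ := h x y hxy h0
    rfl

/-- The operator whose graph is the transform of the span of a frame. -/
def LagFrame.transform (s : ℝ) (b : LagFrame ω) : V →L[ℝ] V :=
  frameMap (b.sndVec s) * Ring.inverse (frameMap (b.fstVec s))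

theorem LagFrame.continuousOn_transform (s : ℝ) :
    ContinuousOn (LagFrame.transform (ω := ω) s) {b | IsRegularAt s b.span.1} := by
  intro b hb
  refine ContinuousAt.continuousWithinAt ?_
  have hb' := (b.isUnit_iff s).mpr hb
  obtain ⟨u, hu⟩ := hb'
  have h1 : ContinuousAt (Ring.inverse : (V →L[ℝ] V) → _) (frameMap (b.fstVec s)) := by
    rw [← hu]; exact NormedRing.inverse_continuousAt u
  have h2 : ContinuousAt (fun b : LagFrame ω => frameMap (b.fstVec s)) b :=
    (continuous_frameMap.comp (LagFrame.continuous_fstVec s)).continuousAt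
  have h3 : ContinuousAt (fun b : LagFrame ω => frameMap (b.sndVec s)) b :=
    (continuous_frameMap.comp (LagFrame.continuous_sndVec s)).continuousAt
  exact h3.mul (ContinuousAt.comp (f := fun b : LagFrame ω => frameMap (b.fstVec s)) h1 h2)

theorem mul_apply_eq (A B : V →L[ℝ] V) (v : V) : (A * B) v = A (B v) := rfl

theorem LagFrame.transform_apply {s : ℝ} {b : LagFrame ω} (hb : IsRegularAt s b.span.1) :
    ∀ x y, (x, y) ∈ b.span.1 → b.transform s (x + s • y) = s • x + y := by
  have hu := (b.isUnit_iff s).mpr hb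
  have hb1 : ∀ i, b.transform s (b.fstVec s i) = b.sndVec s i := by
    intro i
    have h1 : Ring.inverse (frameMap (b.fstVec s)) (b.fstVec s i) = finBasis ℝ V i := by
      have h0 := DFunLike.congr_fun (Ring.inverse_mul_cancel _ hu) (finBasis ℝ V i)
      rw [mul_apply_eq, frameMap_basis] at h0
      exact h0
    rw [LagFrame.transform, mul_apply_eq, h1, frameMap_basis]
  intro x y hxy
  have heq : Set.EqOn ((b.transform s : V →ₗ[ℝ] V) ∘ₗ fstMap V s) (sndMap V s)
      (Set.range b.1) := by
    rintro _ ⟨i, rfl⟩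
    exact hb1 i
  have h := LinearMap.eqOn_span heq (show (x, y) ∈ Submodule.span ℝ (Set.range b.1) from hxy)
  simpa [fstMap, sndMap] using h

variable (hω_alt : ω.IsAlt) (hω : ω.Nondegenerate)
include hω_alt hω

theorem LagFrame.span_surjective : Function.Surjective (LagFrame.span (ω := ω)) := by
  rintro ⟨L, hL⟩
  have hd := hL.finrank_eq hω_alt hω
  set b : Basis (Fin (finrank ℝ V)) ℝ L := (finBasis ℝ L).reindex (finCongr hd) with hb
  have hspan : Submodule.span ℝ (Set.range fun i => (b i : V × V)) = L := by
    have h := congrArg (Submodule.map L.subtype) b.span_eq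
    rw [Submodule.map_span, Submodule.map_top, Submodule.range_subtype, ← Set.range_comp] at h
    exact h
  refine ⟨⟨fun i => b i, b.linearIndependent.map' L.subtype L.ker_subtype, ?_⟩, ?_⟩
  · rw [hspan]; exact hL
  · exact Subtype.ext hspan

theorem isQuotientMap_span : IsQuotientMap (LagFrame.span (ω := ω)) :=
  ⟨⟨rfl⟩, LagFrame.span_surjective hω_alt hω⟩

theorem isOpen_isRegularAt (s : ℝ) : IsOpen {L : LagGr ω | IsRegularAt s L.1} := by
  rw [← (isQuotientMap_span hω_alt hω).isOpen_preimage]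
  have e : LagFrame.span ⁻¹' {L : LagGr ω | IsRegularAt s L.1} =
      (fun b : LagFrame ω => frameMap (b.fstVec s)) ⁻¹' {u | IsUnit u} := by
    ext b
    exact (b.isUnit_iff s).symm
  rw [e]
  exact Units.isOpen.preimage (continuous_frameMap.comp (LagFrame.continuous_fstVec s))

theorem exists_mem_of_isRegularAt {L : Submodule ℝ (V × V)} (hL : IsLagrangian ω L) {s : ℝ}
    (hreg : IsRegularAt s L) (v : V) : ∃ x y, (x, y) ∈ L ∧ x + s • y = v := by
  have hinj : Function.Injective ((fstMap V s).domRestrict L) := by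
    rw [injective_iff_map_eq_zero]
    rintro ⟨⟨x, y⟩, hxy⟩ h0
    obtain ⟨rfl, rfl⟩ := hreg x y hxy h0
    rfl
  obtain ⟨⟨⟨x, y⟩, hxy⟩, h⟩ :=
    (LinearMap.injective_iff_surjective_of_finrank_eq_finrank (hL.finrank_eq hω_alt hω)).mp hinj v
  exact ⟨x, y, hxy, h⟩

/-- On the Lagrangian subspaces regular at `s`, the invariant is read off the transform. -/
theorem exists_continuousOn_eq {s : ℝ} (hs : |s| < 1) :
    ∃ G : LagGr ω → Circle, ContinuousOn G {L | IsRegularAt s L.1} ∧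
      ∀ L : LagGr ω, IsRegularAt s L.1 → dom L.1 ⊓ halo L.1 = ⊥ →
        ∀ D : GraphDecomposition ω L.1, rho D.φ ^ 2 = G L := by
  classical
  -- This section need not be continuous: the transform depends only on the span of the frame, so
  -- continuity is checked on frames and descends to the quotient.
  set σ : LagGr ω → LagFrame ω := Function.surjInv (LagFrame.span_surjective hω_alt hω) with hσ
  have hσs : ∀ L, (σ L).span = L := Function.surjInv_eq _
  set F : (V →L[ℝ] V) → Circle := fun A =>
    circleProd (fun ν => mobius s ν ^ 2) (kreinForm ω) ((A : V →ₗ[ℝ] V).baseChange ℂ) with hF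
  refine ⟨fun L => F ((σ L).transform s), ?_, ?_⟩
  · rw [(isQuotientMap_span hω_alt hω).continuousOn_isOpen_iff (isOpen_isRegularAt hω_alt hω s)]
    have hFc : ContinuousOn F {A | ∀ v w, ω (A v) (A w) = ω v w} := by
      refine continuousOn_circleProd ((continuous_mobius hs).pow 2) ?_ ?_ ?_ hω_alt hω
      · change mobius s 1 ^ 2 = 1
        rw [mobius_one hs, one_pow]
      · change mobius s (-1) ^ 2 = 1
        rw [mobius_neg_one hs, neg_one_sq]
      · intro z
        change mobius s z⁻¹ ^ 2 = (mobius s z ^ 2)⁻¹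
        rw [mobius_inv hs, inv_pow]
    have hmaps : Set.MapsTo (LagFrame.transform (ω := ω) s) {b | IsRegularAt s b.span.1}
        {A | ∀ v w, ω (A v) (A w) = ω v w} := by
      intro b hb
      exact isometry_of_transform b.2.2 (ψ := (b.transform s : V →ₗ[ℝ] V))
        (exists_mem_of_isRegularAt hω_alt hω b.2.2 hb) (LagFrame.transform_apply hb)
    refine (hFc.comp (LagFrame.continuousOn_transform s) hmaps).congr fun b hb => ?_
    have hb1 : IsRegularAt s b.span.1 := hb
    have hb2 : IsRegularAt s (σ b.span).span.1 := by rw [hσs]; exact hb1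
    change F ((σ b.span).transform s) = F (b.transform s)
    congr 1
    refine ContinuousLinearMap.ext fun v => ?_
    obtain ⟨x, y, hxy, rfl⟩ := exists_mem_of_isRegularAt hω_alt hω b.2.2 hb1 v
    rw [LagFrame.transform_apply hb1 x y hxy,
      LagFrame.transform_apply hb2 x y (by rw [hσs]; exact hxy)]
  · intro L hL hH D
    have h2 : IsRegularAt s (σ L).span.1 := by rw [hσs]; exact hL
    refine D.rho_sq_eq (ψ := ((σ L).transform s : V →ₗ[ℝ] V)) hs ?_ L.2 hω_alt hω hH
    intro x y hxy
    exact LagFrame.transform_apply h2 x y (by rw [hσs]; exact hxy)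

omit hω_alt hω [FiniteDimensional ℝ V] in
theorem dom_inf_halo_eq_bot [FiniteDimensional ℝ V] (L : ↥(exceptionalSet ω)ᶜ) :
    dom L.1.1 ⊓ halo L.1.1 = ⊥ := by
  have h : ¬ 1 ≤ finrank ℝ ↥(dom L.1.1 ⊓ halo L.1.1) := L.2
  exact Submodule.finrank_eq_zero.mp (by omega)

theorem unique_graphDecomposition (L : ↥(exceptionalSet ω)ᶜ) :
    Nonempty (Unique (GraphDecomposition ω L.1.1)) := by
  have hH := dom_inf_halo_eq_bot L
  obtain ⟨D⟩ := L.1.2.nonempty_graphDecomposition hω_alt hω hH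
  exact ⟨⟨⟨D⟩, fun D' => GraphDecomposition.eq L.1.2 hω_alt hω hH D' D⟩⟩

/-- Near each `L` one value of `s` works for all relations, because regularity at `s` is an open
condition. -/
theorem continuous_rho_sq (D : ∀ L : ↥(exceptionalSet ω)ᶜ, GraphDecomposition ω L.1.1) :
    Continuous fun L => rho (D L).φ ^ 2 := by
  rw [continuous_iff_continuousAt]
  intro L
  have h1 : ∀ᶠ s in 𝓝[>] (0 : ℝ), s < 1 :=
    mem_nhdsWithin_of_mem_nhds (Iio_mem_nhds one_pos)
  obtain ⟨s, ⟨hreg, hs1⟩, hs0⟩ :=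
    (((D L).eventually_isRegularAt.and h1).and self_mem_nhdsWithin).exists
  have hs : |s| < 1 := by rwa [abs_of_pos hs0]
  obtain ⟨G, hG, hGe⟩ := exists_continuousOn_eq hω_alt hω hs
  have hopen := isOpen_isRegularAt hω_alt hω s
  have hGL : ContinuousAt (fun L : ↥(exceptionalSet ω)ᶜ => G L.1) L :=
    ContinuousAt.comp (f := Subtype.val) (hG.continuousAt (hopen.mem_nhds hreg))
      continuous_subtype_val.continuousAt
  refine hGL.congr ?_
  filter_upwards [(hopen.preimage continuous_subtype_val).mem_nhds hreg] with L' hL'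
  exact (hGe L'.1 hL' (dom_inf_halo_eq_bot L') (D L')).symm

/-- At `s = 0` the transform of a graph is the map itself and the Möbius map is the identity. -/
theorem rho_sq_of_graph (φ : Sp ω) (D : GraphDecomposition ω (Gr hω φ).1.1) :
    rho D.φ ^ 2 = rho φ ^ 2 := by
  rw [D.rho_sq_eq (ψ := (φ.1 : V →ₗ[ℝ] V)) (s := 0) (by simp) ?_ (Gr hω φ).1.2 hω_alt hω
    (dom_inf_halo_eq_bot _), rho_sq]
  · congr 1
    funext ν
    rw [mobius_zero]
  · intro x y hxy
    have : y = φ.1 x := by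
      have h := hxy
      change (x, y) ∈ (φ.1 : V →ₗ[ℝ] V).graph at h
      rw [LinearMap.mem_graph_iff] at h
      exact h
    rw [zero_smul, zero_smul, add_zero, zero_add, this]
    rfl

theorem exists_graph_of_isRegularAt {s : ℝ} (b : LagFrame ω) (hreg : IsRegularAt s b.span.1) :
    ∃ φ : Sp ω, Submodule.span ℝ (Set.range fun i => (b.fstVec s i, b.sndVec s i)) = graph φ.1 ∧
      LinearIndependent ℝ fun i => (b.fstVec s i, b.sndVec s i) := by
  have hiso := isometry_of_transform b.2.2 (ψ := (b.transform s : V →ₗ[ℝ] V))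
    (exists_mem_of_isRegularAt hω_alt hω b.2.2 hreg) (LagFrame.transform_apply hreg)
  have hinj : Function.Injective (b.transform s : V →ₗ[ℝ] V) := by
    rw [injective_iff_map_eq_zero]
    intro x hx
    refine hω.1 x fun y => ?_
    rw [← hiso, hx, map_zero, LinearMap.zero_apply]
  set φ : Sp ω := ⟨LinearEquiv.ofInjectiveEndo _ hinj, hiso⟩ with hφ
  have hli : LinearIndependent ℝ fun i => (b.fstVec s i, b.sndVec s i) :=
    LinearIndependent.of_comp (LinearMap.fst ℝ V V)
      ((isUnit_frameMap_iff _).mp ((b.isUnit_iff s).mpr hreg))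
  refine ⟨φ, Submodule.eq_of_le_of_finrank_le ?_ ?_, hli⟩
  · rw [Submodule.span_le]
    rintro _ ⟨i, rfl⟩
    rw [SetLike.mem_coe, graph, LinearMap.mem_graph_iff]
    exact (LagFrame.transform_apply hreg (b.1 i).1 (b.1 i).2
      (Submodule.subset_span ⟨i, rfl⟩)).symm
  · rw [finrank_span_eq_card hli, Fintype.card_fin,
      (isLagrangian_graph hω φ).finrank_eq hω_alt hω]

/-- The transformed frames tend to the original one as $s\to0$, and for small $s>0$ each spans the
graph of a symplectic map. -/
theorem denseRange_Gr : DenseRange (Gr hω) := by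
  intro L
  rw [mem_closure_iff]
  intro O hO hLO
  obtain ⟨O', hO', rfl⟩ := isOpen_induced_iff.mp hO
  obtain ⟨b, hb⟩ := LagFrame.span_surjective hω_alt hω L.1
  have hpre : IsOpen (LagFrame.span ⁻¹' O') :=
    hO'.preimage (isQuotientMap_span hω_alt hω).continuous
  obtain ⟨Q, hQ, hQe⟩ := isOpen_induced_iff.mp hpre
  have hbQ : b.1 ∈ Q := by
    have : b ∈ LagFrame.span ⁻¹' O' := by rw [Set.mem_preimage, hb]; exact hLO
    rw [← hQe] at this
    exact this
  have hcont : Continuous fun s : ℝ => fun i => (b.fstVec s i, b.sndVec s i) := by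
    unfold LagFrame.fstVec LagFrame.sndVec
    fun_prop
  have h0 : (fun i => (b.fstVec 0 i, b.sndVec 0 i)) = b.1 := by
    funext i
    simp [LagFrame.fstVec, LagFrame.sndVec]
  have hev : ∀ᶠ s in 𝓝[>] (0 : ℝ), (fun i => (b.fstVec s i, b.sndVec s i)) ∈ Q := by
    refine mem_nhdsWithin_of_mem_nhds (hcont.continuousAt.preimage_mem_nhds (hQ.mem_nhds ?_))
    rw [h0]
    exact hbQ
  obtain ⟨D⟩ := L.1.2.nonempty_graphDecomposition hω_alt hω (dom_inf_halo_eq_bot L)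
  obtain ⟨s, hreg, hsQ⟩ := (D.eventually_isRegularAt.and hev).exists
  rw [← hb] at hreg
  obtain ⟨φ, hφ, hli⟩ := exists_graph_of_isRegularAt hω_alt hω b hreg
  refine ⟨Gr hω φ, ?_, φ, rfl⟩
  set b' : LagFrame ω := ⟨fun i => (b.fstVec s i, b.sndVec s i), hli, by
    rw [hφ]; exact isLagrangian_graph hω φ⟩ with hb'
  have h1 : b' ∈ LagFrame.span ⁻¹' O' := by rw [← hQe]; exact hsQ
  have h2 : b'.span = (Gr hω φ).1 := Subtype.ext hφ
  rw [Set.mem_preimage, h2] at h1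
  exact h1

end Topology

end LagRel

end

/-! ### Assembly of existence, uniqueness and the formula. -/

theorem theorem2 {V : Type*} [NormedAddCommGroup V] [NormedSpace ℝ V] [FiniteDimensional ℝ V]
    (ω : LinearMap.BilinForm ℝ V) (hω_alt : ω.IsAlt) (hω : ω.Nondegenerate) :
    (∃! ρhat : ↥(LagRel.exceptionalSet ω)ᶜ → Circle,
      Continuous ρhat ∧ ∀ φ : LagRel.Sp ω, ρhat (LagRel.Gr hω φ) = LagRel.rho φ ^ 2) ∧
    (∀ L : ↥(LagRel.exceptionalSet ω)ᶜ, Nonempty (Unique (LagRel.GraphDecomposition ω L.1.1))) ∧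
    (∀ ρhat : ↥(LagRel.exceptionalSet ω)ᶜ → Circle,
      (Continuous ρhat ∧ ∀ φ : LagRel.Sp ω, ρhat (LagRel.Gr hω φ) = LagRel.rho φ ^ 2) →
      ∀ (L : ↥(LagRel.exceptionalSet ω)ᶜ) (D : LagRel.GraphDecomposition ω L.1.1),
        ρhat L = LagRel.rho D.φ ^ 2) := by
  have huniq := LagRel.unique_graphDecomposition hω_alt hω
  let D L := (huniq L).some.default
  have hcont := LagRel.continuous_rho_sq hω_alt hω D
  have hext : ∀ ρhat : ↥(LagRel.exceptionalSet ω)ᶜ → Circle,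
      (Continuous ρhat ∧ ∀ φ : LagRel.Sp ω, ρhat (LagRel.Gr hω φ) = LagRel.rho φ ^ 2) →
      ρhat = fun L => LagRel.rho (D L).φ ^ 2 := by
    rintro ρhat ⟨hc, hv⟩
    refine (LagRel.denseRange_Gr hω_alt hω).equalizer hc hcont (funext fun φ => ?_)
    exact (hv φ).trans (LagRel.rho_sq_of_graph hω_alt hω φ _).symm
  refine ⟨⟨_, ⟨hcont, fun φ => LagRel.rho_sq_of_graph hω_alt hω φ _⟩, hext⟩, huniq, ?_⟩
  intro ρhat h L D'
  have : D' = D L := (huniq L).some.uniq _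
  rw [hext ρhat h, this]
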